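/- **Notation.** For Borel probability measures $\alpha,\beta$ on finite-dimensional Euclidean spaces $X,Y$, the Gaussian-restricted Gromov–Wasserstein (GGW) problem is $$\inf_{\gamma}\ \iint \big(\|x-x'\|^2-\|y-y'\|^2\big)^2\,d\gamma(x,y)\,d\gamma(x',y'),$$ over all couplings $\gamma$ of $\alpha$ and $\beta$ that are (possibly degenerate) Gaussian measures on $X\times Y$. A minimizer is a GGW-optimal plan. A measurable map $T$ is a GGW-optimal map if $(\mathrm{Id},T)_\#\alpha$ is a GGW-optimal plan. Let $E\subset\mathbb R^p$ and $F\subset\mathbb R^q$ be subspaces, and let $\mu,\nu$ be probability measures on $\mathbb R^p,\mathbb R^q$. Write $\mu_E=\pi^E_\#\mu$ and $\nu_F=\pi^F_\#\nu$ (orthogonal projections), and let $\mu_{E^\perp|E}$, $\nu_{F^\perp|F}$ be the disintegrations of $\mu,\nu$ over $E,F$. A Monge–Knothe plan is a coupling $\pi$ of $\mu$ and $\nu$ such that: * $\gamma^*_{E,F}=(\pi^E,\pi^F)_\#\pi$ is a GGW-optimal plan between $\mu_E$ and $\nu_F$; * for $\gamma^*_{E,F}$-almost every $(x_E,y_F)$,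 the disintegration of $\pi$ over $E\times F$ at $(x_E,y_F)$ is a GGW-optimal plan between $\mu_{E^\perp|E}(x_E,\cdot)$ and $\nu_{F^\perp|F}(y_F,\cdot)$. A measurable map $T$ is a Monge–Knothe map if $(\mathrm{Id},T)_\#\mu$ is a Monge–Knothe plan. **Setting.** Let $p\ge q$, let $\dim E=\dim F=k$, and let $\mu=\mathcal N(m_\mu,\Sigma)$ on $\mathbb R^p$ and $\nu=\mathcal N(m_\nu,\Lambda)$ on $\mathbb R^q$. Write $\Sigma=\begin{pmatrix}\Sigma_E&\Sigma_{EE^\perp}\\ \Sigma_{E^\perp E}&\Sigma_{E^\perp}\end{pmatrix}$ and $\Lambda=\begin{pmatrix}\Lambda_F&\Lambda_{FF^\perp}\\ \Lambda_{F^\perp F}&\Lambda_{F^\perp}\end{pmatrix}$ in orthonormal bases of $E\oplus E^\perp$ and $F\oplus F^\perp$. Assume that $\Sigma_E$ and $\Lambda_F$ are positive definite, and put $$\Sigma/\Sigma_E=\Sigma_{E^\perp}-\Sigma_{EE^\perp}^T\Sigma_E^{-1}\Sigma_{EE^\perp},\qquad \Lambda/\Lambda_F=\Lambda_{F^\perp}-\Lambda_{FF^\perp}^T\Lambda_F^{-1}\Lambda_{FF^\perp}.$$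 For $n\le m$ and covariance matrices $S\in\mathbb R^{m\times m}$, $L\in\mathbb R^{n\times n}$, say that $T\in\mathbb R^{n\times m}$ is *of spectral form* for $(S,L)$ if $T=QAP^T$, where $S=PDP^T$ and $L=QD'Q^T$ are orthogonal diagonalizations with eigenvalues in nonincreasing order, the $n$ largest eigenvalues of $S$ are positive, $D^{(n)}$ is the leading $n\times n$ block of $D$, and $$A=\begin{pmatrix}\tilde I\,D'^{1/2}(D^{(n)})^{-1/2}&0_{n,m-n}\end{pmatrix},\qquad \tilde I=\mathrm{diag}(\pm1,\dots,\pm1).$$ **Proposition (Monge–Knothe closed form between Gaussians).** 1. There is a map of spectral form for $(\Sigma_E,\Lambda_F)$ and, if $\Sigma$ is positive definite, one for $(\Sigma/\Sigma_E,\Lambda/\Lambda_F)$. Every map of spectral form for $(\Sigma_E,\Lambda_F)$ is a GGW-optimal map between $\mathcal N(0,\Sigma_E)$ and $\mathcal N(0,\Lambda_F)$. Every map of spectral form for $(\Sigma/\Sigma_E,\Lambda/\Lambda_F)$ is a GGW-optimal map between $\mathcal N(0,\Sigma/\Sigma_E)$ and $\mathcal N(0,\Lambda/\Lambda_F)$.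 2. Let $T_{E,F}$ be any linear GGW-optimal map between $\mathcal N(0,\Sigma_E)$ and $\mathcal N(0,\Lambda_F)$, and $T_{E^\perp,F^\perp|E,F}$ any linear GGW-optimal map between $\mathcal N(0,\Sigma/\Sigma_E)$ and $\mathcal N(0,\Lambda/\Lambda_F)$. Then $T_{E,F}$ is invertible, and a Monge–Knothe map between $\mu$ and $\nu$ is $$T_{\mathrm{MK}}(x)=m_\nu+B(x-m_\mu),\qquad B=\begin{pmatrix}T_{E,F}&0\\ C&T_{E^\perp,F^\perp|E,F}\end{pmatrix},$$ $$C=\big(\Lambda_{F^\perp F}(T_{E,F}^T)^{-1}-T_{E^\perp,F^\perp|E,F}\Sigma_{E^\perp E}\big)\Sigma_E^{-1},$$ where $B$ is written in the chosen orthonormal bases. -/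

import Mathlib

open MeasureTheory ProbabilityTheory
open scoped ENNReal Matrix

namespace GaussianDetour

section GromovWasserstein

variable {X Y : Type*}
  [NormedAddCommGroup X] [InnerProductSpace ℝ X] [MeasurableSpace X]
  [NormedAddCommGroup Y] [InnerProductSpace ℝ Y] [MeasurableSpace Y]

/-- `γ` is a coupling of `μ` and `ν`. -/
def IsCoupling {X Y : Type*} [MeasurableSpace X] [MeasurableSpace Y]
    (μ : Measure X) (ν : Measure Y) (γ : Measure (X × Y)) : Prop :=
  γ.map Prod.fst = μ ∧ γ.map Prod.snd = ν

/-- The quadratic Gromov-Wasserstein cost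
`∬ (‖x - x'‖² - ‖y - y'‖²)² dγ(x, y) dγ(x', y')`, with values in `[0, ∞]`. -/
noncomputable def gwCost (γ : Measure (X × Y)) : ℝ≥0∞ :=
  ∫⁻ z, ∫⁻ z', ENNReal.ofReal ((‖z.1 - z'.1‖ ^ 2 - ‖z.2 - z'.2‖ ^ 2) ^ 2) ∂γ ∂γ

/-- `γ` is an optimal plan of the Gaussian-restricted Gromov-Wasserstein problem between `μ` and
`ν`: it minimizes the cost among the couplings of `μ` and `ν` that are (possibly degenerate)
Gaussian measures on `X × Y`. -/
def IsGGWPlan (μ : Measure X) (ν : Measure Y) (γ : Measure (X × Y)) : Prop :=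
  (IsCoupling μ ν γ ∧ IsGaussian γ) ∧
    ∀ γ' : Measure (X × Y), IsCoupling μ ν γ' → IsGaussian γ' → gwCost γ ≤ gwCost γ'

/-- `T` is an optimal transport map of the Gaussian-restricted problem: `(Id, T)_# μ` is an
optimal plan. -/
def IsGGWMap (μ : Measure X) (ν : Measure Y) (T : X → Y) : Prop :=
  Measurable T ∧ IsGGWPlan μ ν (μ.map fun x => (x, T x))

end GromovWasserstein

section MongeKnothe

variable {V W : Type*}
  [NormedAddCommGroup V] [InnerProductSpace ℝ V] [FiniteDimensional ℝ V] [MeasurableSpace V]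
  [NormedAddCommGroup W] [InnerProductSpace ℝ W] [FiniteDimensional ℝ W] [MeasurableSpace W]

/-- The orthogonal projection `π^E` of `V` onto the subspace `E`. -/
noncomputable def proj (E : Submodule ℝ V) (x : V) : E := E.orthogonalProjectionOnto x

/-- The law of `(π^E x, π^{Eᗮ} x)` under `μ`. -/
noncomputable def splitMeasure (E : Submodule ℝ V) (μ : Measure V) : Measure (E × Eᗮ) :=
  μ.map fun x => (proj E x, proj Eᗮ x)

/-- The law of `((π^E x, π^F y), (π^{Eᗮ} x, π^{Fᗮ} y))` under `π`. -/
noncomputable def splitPlan (E : Submodule ℝ V) (F : Submodule ℝ W) (π : Measure (V × W)) :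
    Measure ((E × F) × (Eᗮ × Fᗮ)) :=
  π.map fun z => ((proj E z.1, proj F z.2), (proj Eᗮ z.1, proj Fᗮ z.2))

/-- `π` is a Monge-Knothe plan `γ*_{E,F} ⊗ γ*_{Eᗮ × Fᗮ | E × F}` for the Gaussian-restricted
Gromov-Wasserstein problem: it couples `μ` and `ν`; its image `γ*_{E,F}` on `E × F` is an optimal
plan between `μ_E` and `ν_F`; and its disintegration over `E × F` is, at `γ*_{E,F}`-almost
every `(x_E, y_F)`, an optimal plan between the disintegrations `μ_{Eᗮ|E}(x_E, ·)` and
`ν_{Fᗮ|F}(y_F, ·)`. Disintegrations are unique almost everywhere. -/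
def IsMongeKnothePlan (E : Submodule ℝ V) (F : Submodule ℝ W) (μ : Measure V) (ν : Measure W)
    (π : Measure (V × W)) : Prop :=
  IsCoupling μ ν π ∧
  IsGGWPlan (μ.map (proj E)) (ν.map (proj F)) (π.map fun z => (proj E z.1, proj F z.2)) ∧
  ∃ (κμ : Kernel E Eᗮ) (κν : Kernel F Fᗮ) (κ : Kernel (E × F) (Eᗮ × Fᗮ)),
    IsMarkovKernel κμ ∧ IsMarkovKernel κν ∧ IsMarkovKernel κ ∧
    (splitMeasure E μ).IsCondKernel κμ ∧
    (splitMeasure F ν).IsCondKernel κν ∧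
    (splitPlan E F π).IsCondKernel κ ∧
    ∀ᵐ z ∂(π.map fun z => (proj E z.1, proj F z.2)), IsGGWPlan (κμ z.1) (κν z.2) (κ z)

/-- `T` is a Monge-Knothe transport map: `(Id, T)_# μ` is a Monge-Knothe plan. -/
def IsMongeKnotheMap (E : Submodule ℝ V) (F : Submodule ℝ W) (μ : Measure V) (ν : Measure W)
    (T : V → W) : Prop :=
  Measurable T ∧ IsMongeKnothePlan E F μ ν (μ.map fun x => (x, T x))

end MongeKnothe

section Matrices

/-- The orthonormal basis `b` of `ℝⁿ` is adapted to `E ⊕ Eᗮ`: the first family of vectors lies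
in `E` (and is therefore a basis of it), the second one in `Eᗮ`. -/
def IsAdapted {n k r : ℕ} (E : Submodule ℝ (EuclideanSpace ℝ (Fin n)))
    (b : OrthonormalBasis (Fin k ⊕ Fin r) ℝ (EuclideanSpace ℝ (Fin n))) : Prop :=
  (∀ i, b (Sum.inl i) ∈ E) ∧ ∀ j, b (Sum.inr j) ∈ Eᗮ

/-- The matrix of the symmetric bilinear form `S` in the orthonormal basis `b`. -/
noncomputable def inBasis {n k r : ℕ}
    (b : OrthonormalBasis (Fin k ⊕ Fin r) ℝ (EuclideanSpace ℝ (Fin n)))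
    (S : Matrix (Fin n) (Fin n) ℝ) : Matrix (Fin k ⊕ Fin r) (Fin k ⊕ Fin r) ℝ :=
  Matrix.of fun i j => inner ℝ (b i) (S.toEuclideanLin (b j))

/-- The Schur complement `M / M₁₁ = M₂₂ - M₁₂ᵀ M₁₁⁻¹ M₁₂`. -/
noncomputable def schur {k r : ℕ} (M : Matrix (Fin k ⊕ Fin r) (Fin k ⊕ Fin r) ℝ) :
    Matrix (Fin r) (Fin r) ℝ :=
  M.toBlocks₂₂ - M.toBlocks₁₂ᵀ * M.toBlocks₁₁⁻¹ * M.toBlocks₁₂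

/-- For `n ≤ m`, `T = Q A Pᵀ` with `S = P diag(d) Pᵀ`, `L = Q diag(e) Qᵀ` orthogonal
diagonalizations with eigenvalues in nonincreasing order, the `n` largest eigenvalues of `S` being
positive, and `A = (diag(±1) diag(e)^{1/2} diag(d₁, …, dₙ)^{-1/2}  0)`, an `n × m` matrix. -/
def IsSpectralMap {m n : ℕ} (S : Matrix (Fin m) (Fin m) ℝ) (L : Matrix (Fin n) (Fin n) ℝ)
    (T : Matrix (Fin n) (Fin m) ℝ) : Prop :=
  ∃ (P : Matrix (Fin m) (Fin m) ℝ) (d : Fin m → ℝ)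
    (Q : Matrix (Fin n) (Fin n) ℝ) (e : Fin n → ℝ) (ε : Fin n → ℝ),
    P ∈ Matrix.orthogonalGroup (Fin m) ℝ ∧ Antitone d ∧ S = P * Matrix.diagonal d * Pᵀ ∧
    Q ∈ Matrix.orthogonalGroup (Fin n) ℝ ∧ Antitone e ∧ L = Q * Matrix.diagonal e * Qᵀ ∧
    (∀ j : Fin m, (j : ℕ) < n → 0 < d j) ∧ (∀ i, ε i = 1 ∨ ε i = -1) ∧
    T = Q * (Matrix.of fun (i : Fin n) (j : Fin m) =>
      if (i : ℕ) = (j : ℕ) then ε i * √(e i) * (√(d j))⁻¹ else 0) * Pᵀ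

/-- The linear map `T` is an optimal transport map of the Gaussian-restricted problem between
the centered Gaussians `N(0, S)` and `N(0, L)`. -/
def IsGGWMatrix {m n : ℕ} (S : Matrix (Fin m) (Fin m) ℝ) (L : Matrix (Fin n) (Fin n) ℝ)
    (T : Matrix (Fin n) (Fin m) ℝ) : Prop :=
  IsGGWMap (multivariateGaussian 0 S) (multivariateGaussian 0 L) T.toEuclideanLin

/-- The block `C = (Λ₂₁ (T₁ᵀ)⁻¹ - T₂ Σ₂₁) Σ₁₁⁻¹`. -/
noncomputable def lowerBlock {k r s : ℕ} (M : Matrix (Fin k ⊕ Fin r) (Fin k ⊕ Fin r) ℝ)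
    (N : Matrix (Fin k ⊕ Fin s) (Fin k ⊕ Fin s) ℝ)
    (T₁ : Matrix (Fin k) (Fin k) ℝ) (T₂ : Matrix (Fin s) (Fin r) ℝ) :
    Matrix (Fin s) (Fin k) ℝ :=
  (N.toBlocks₂₁ * (T₁ᵀ)⁻¹ - T₂ * M.toBlocks₂₁) * M.toBlocks₁₁⁻¹

/-- The affine map `x ↦ m' + B (x - m)`, where the matrix `B` is written in the orthonormal
bases `b` and `c`. -/
noncomputable def affineInBases {p q k r s : ℕ}
    (b : OrthonormalBasis (Fin k ⊕ Fin r) ℝ (EuclideanSpace ℝ (Fin p)))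
    (c : OrthonormalBasis (Fin k ⊕ Fin s) ℝ (EuclideanSpace ℝ (Fin q)))
    (m : EuclideanSpace ℝ (Fin p)) (m' : EuclideanSpace ℝ (Fin q))
    (B : Matrix (Fin k ⊕ Fin s) (Fin k ⊕ Fin r) ℝ) (x : EuclideanSpace ℝ (Fin p)) :
    EuclideanSpace ℝ (Fin q) :=
  m' + c.repr.symm (B.toEuclideanLin (b.repr (x - m)))

end Matrices

end GaussianDetour

namespace GaussianDetour

/-! ### Fourth moments of centred Gaussian measures. -/

section Moments

/-! The cost of a plan is the second moment of the quadratic form ‖x‖² - ‖y‖² under the law of the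
difference of two independent samples. For a Gaussian plan that law is a centred Gaussian with twice
the covariance, and Isserlis' formula turns the cost into a polynomial in the covariances
(`gwCost_eq`). The marginals fix every term except -16 ‖K‖², where K is the cross-covariance and the
norm is Frobenius. Optimality thus means maximal ‖K‖.

In eigenbases of the two marginal covariances, the joint covariance is positive semidefinite with
diagonal blocks diag(d), diag(e). Schur complements then make the weights K i j² / (d i e j) doubly
substochastic, and a rearrangement inequality, proved by linear programming duality, gives ‖K‖² ≤ ∑
d j e j (`sum_sq_le_of_semidefinite`). A map of spectral form attains this bound
(`IsSpectralMap.isGGWMatrix`).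

For the Monge-Knothe map, μ is the image of a product of centred Gaussians, with covariances Σ_E and
Σ/Σ_E, under (z, ξ) ↦ m + z + (R z + ξ), where R is the regression matrix (`map_glue_prod`);
likewise for ν with R'. The block C is exactly the one for which C + T₂ R = R' T₁
(`lowerBlock_add_mul_regression`), so in the independent coordinates the map is just (z, ξ) ↦ (T₁ z,
T₂ ξ). Independence makes the disintegrations explicit (`isCondKernel_imageKernel`): each is an
affine isometric copy of the optimal plan given by T₂, and such copies stay optimal
(`IsGGWPlan.map_affine`). -/

lemma integral_pow_four_gaussianReal (v : NNReal) :
    ∫ x, x ^ 4 ∂(gaussianReal 0 v) = 3 * (v : ℝ) ^ 2 := by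
  have h : (gaussianReal 0 v)[id ^ 4] = iteratedDeriv 4 (mgf id (gaussianReal 0 v)) 0 :=
    (iteratedDeriv_mgf_zero (by simp) 4).symm
  -- Differentiation preserves the form p(t) exp(v t² / 2), acting on p by p ↦ p' + v X p; four
  -- iterations from p = 1, evaluated at 0, give the moment.
  have e : ∀ p : Polynomial ℝ, deriv (fun t : ℝ => p.eval t * Real.exp (v * t ^ 2 / 2)) =
      fun t => (Polynomial.derivative p + Polynomial.C (v : ℝ) * Polynomial.X * p).eval t *
        Real.exp (v * t ^ 2 / 2) := by
    intro p
    ext t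
    have h1 : HasDerivAt (fun t : ℝ => Real.exp (v * t ^ 2 / 2))
        (Real.exp (v * t ^ 2 / 2) * (v * t)) t := by
      have : HasDerivAt (fun t : ℝ => (v : ℝ) * t ^ 2 / 2) (v * t) t := by
        have := (((hasDerivAt_pow 2 t).const_mul (v : ℝ)).div_const 2)
        exact this.congr_deriv (by push_cast; ring)
      exact this.exp
    refine (((p.hasDerivAt t).mul h1).congr_deriv ?_).deriv
    simp only [Polynomial.eval_add, Polynomial.eval_mul, Polynomial.eval_C, Polynomial.eval_X]
    ring
  have h3 : mgf id (gaussianReal 0 v) =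
      fun t : ℝ => (1 : Polynomial ℝ).eval t * Real.exp (v * t ^ 2 / 2) := by
    rw [mgf_id_gaussianReal]; ext t; simp
  rw [h3] at h
  simp only [iteratedDeriv_succ, iteratedDeriv_zero, e] at h
  simp at h
  convert h using 1
  ring

variable {Z : Type*} [NormedAddCommGroup Z] [NormedSpace ℝ Z]
  [MeasurableSpace Z] [BorelSpace Z] {ρ : Measure Z} [IsGaussian ρ]

lemma integral_pow_four_of_isGaussian (h0 : ∀ M : StrongDual ℝ Z, ρ[M] = 0)
    (L : StrongDual ℝ Z) :
    ∫ z, L z ^ 4 ∂ρ = 3 * (∫ z, L z ^ 2 ∂ρ) ^ 2 := by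
  have h1 : ρ.map L = gaussianReal 0 (Var[L; ρ]).toNNReal := by
    rw [IsGaussian.map_eq_gaussianReal, h0]
  have h2 : Var[L; ρ] = ∫ z, L z ^ 2 ∂ρ :=
    variance_of_integral_eq_zero L.continuous.measurable.aemeasurable (h0 L)
  rw [← h2]
  have h3 := integral_pow_four_gaussianReal (Var[L; ρ]).toNNReal
  rw [← h1, integral_map (by fun_prop) (by fun_prop),
    Real.coe_toNNReal _ (variance_nonneg _ _)] at h3
  exact h3

lemma integrable_dual_mul_four (L₁ L₂ L₃ L₄ : StrongDual ℝ Z) :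
    Integrable (fun z => L₁ z * L₂ z * (L₃ z * L₄ z)) ρ := by
  have h : ∀ L : StrongDual ℝ Z, MemLp L 4 ρ := fun L => IsGaussian.memLp_dual ρ L 4 (by norm_num)
  have : ENNReal.HolderTriple 4 4 2 := ⟨by
    rw [← ENNReal.toReal_eq_toReal_iff' (by simp) (by simp)]
    rw [ENNReal.toReal_add (by simp) (by simp)]; norm_num⟩
  have h12 : MemLp (fun z => L₁ z * L₂ z) 2 ρ := (h L₂).mul (h L₁)
  have h34 : MemLp (fun z => L₃ z * L₄ z) 2 ρ := (h L₄).mul (h L₃)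
  exact h12.integrable_mul h34

lemma integrable_dual_mul (L M : StrongDual ℝ Z) : Integrable (fun z => L z * M z) ρ :=
  (IsGaussian.memLp_dual ρ L 2 (by norm_num)).integrable_mul
    (IsGaussian.memLp_dual ρ M 2 (by norm_num))

/-- Polarization, 12 a² b² = (a + b)⁴ + (a - b)⁴ - 2 a⁴ - 2 b⁴, reduces the mixed moment to fourth
moments of single functionals, which are known from their one-dimensional laws. -/
lemma integral_sq_mul_sq_of_isGaussian (h0 : ∀ M : StrongDual ℝ Z, ρ[M] = 0)
    (L M : StrongDual ℝ Z) :
    ∫ z, L z ^ 2 * M z ^ 2 ∂ρ =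
      (∫ z, L z * L z ∂ρ) * (∫ z, M z * M z ∂ρ) + 2 * (∫ z, L z * M z ∂ρ) ^ 2 := by
  have i4 : ∀ L₁ L₂ : StrongDual ℝ Z, Integrable (fun z => L₁ z ^ 2 * L₂ z ^ 2) ρ := fun L₁ L₂ =>
    (integrable_dual_mul_four L₁ L₁ L₂ L₂).congr (.of_forall fun z => by simp only; ring)
  have i4' : ∀ L₁ : StrongDual ℝ Z, Integrable (fun z => L₁ z ^ 4) ρ := fun L₁ =>
    (i4 L₁ L₁).congr (.of_forall fun z => by simp only; ring)
  have e1 : ∫ z, 12 * (L z ^ 2 * M z ^ 2) ∂ρ =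
      ∫ z, ((L + M) z ^ 4 + (L - M) z ^ 4 - 2 * L z ^ 4 - 2 * M z ^ 4) ∂ρ :=
    integral_congr_ae (.of_forall fun z => by simp; ring)
  rw [integral_const_mul, integral_sub, integral_sub, integral_add, integral_const_mul,
    integral_const_mul, integral_pow_four_of_isGaussian h0, integral_pow_four_of_isGaussian h0,
    integral_pow_four_of_isGaussian h0, integral_pow_four_of_isGaussian h0] at e1
  rotate_left
  · exact i4' _
  · exact i4' _
  · exact (i4' _).add (i4' _)
  · exact (i4' _).const_mul _
  · exact ((i4' _).add (i4' _)).sub ((i4' _).const_mul _)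
  · exact (i4' _).const_mul _
  have e2 : ∫ z, (L + M) z ^ 2 ∂ρ =
      ∫ z, L z * L z ∂ρ + 2 * ∫ z, L z * M z ∂ρ + ∫ z, M z * M z ∂ρ := by
    rw [← integral_const_mul, ← integral_add, ← integral_add]
    · exact integral_congr_ae (.of_forall fun z => by simp; ring)
    · exact (integrable_dual_mul _ _).add ((integrable_dual_mul _ _).const_mul _)
    · exact integrable_dual_mul _ _
    · exact integrable_dual_mul _ _
    · exact (integrable_dual_mul _ _).const_mul _
  have e3 : ∫ z, (L - M) z ^ 2 ∂ρ =
      ∫ z, L z * L z ∂ρ - 2 * ∫ z, L z * M z ∂ρ + ∫ z, M z * M z ∂ρ := by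
    rw [← integral_const_mul, ← integral_sub, ← integral_add]
    · exact integral_congr_ae (.of_forall fun z => by simp; ring)
    · exact (integrable_dual_mul _ _).sub ((integrable_dual_mul _ _).const_mul _)
    · exact integrable_dual_mul _ _
    · exact integrable_dual_mul _ _
    · exact (integrable_dual_mul _ _).const_mul _
  rw [e2, e3] at e1
  simp only [pow_two (L _), pow_two (M _)] at e1 ⊢
  nlinarith

/-- Isserlis' formula for the square of a diagonal quadratic form. -/
lemma integral_sq_sum_sq_of_isGaussian (h0 : ∀ M : StrongDual ℝ Z, ρ[M] = 0)
    {ι : Type*} [Fintype ι] (ε : ι → ℝ) (L : ι → StrongDual ℝ Z) :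
    Integrable (fun z => (∑ i, ε i * L i z ^ 2) ^ 2) ρ ∧
    ∫ z, (∑ i, ε i * L i z ^ 2) ^ 2 ∂ρ = (∑ i, ε i * ∫ z, L i z * L i z ∂ρ) ^ 2 +
      2 * ∑ i, ∑ j, ε i * ε j * (∫ z, L i z * L j z ∂ρ) ^ 2 := by
  have i4 : ∀ i j, Integrable (fun z => ε i * ε j * (L i z ^ 2 * L j z ^ 2)) ρ := fun i j =>
    ((integrable_dual_mul_four (L i) (L i) (L j) (L j)).congr
      (.of_forall fun z => by simp only; ring)).const_mul _
  have e : ∀ z, (∑ i, ε i * L i z ^ 2) ^ 2 =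
      ∑ i, ∑ j, ε i * ε j * (L i z ^ 2 * L j z ^ 2) := by
    intro z
    rw [pow_two, Finset.sum_mul_sum]
    exact Finset.sum_congr rfl fun i _ => Finset.sum_congr rfl fun j _ => by ring
  simp only [e]
  refine ⟨integrable_finsetSum _ fun i _ => integrable_finsetSum _ fun j _ => i4 i j, ?_⟩
  rw [integral_finsetSum _ fun i _ => integrable_finsetSum _ fun j _ => i4 i j]
  simp_rw [integral_finsetSum _ fun j _ => i4 _ j, integral_const_mul,
    integral_sq_mul_sq_of_isGaussian h0, mul_add, Finset.sum_add_distrib]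
  congr 1
  · rw [pow_two, Finset.sum_mul_sum]
    exact Finset.sum_congr rfl fun i _ => Finset.sum_congr rfl fun j _ => by ring
  · simp_rw [Finset.mul_sum]
    exact Finset.sum_congr rfl fun i _ => Finset.sum_congr rfl fun j _ => by ring

end Moments

/-! ### The cost of a Gaussian plan through its covariances. -/

section Cost

section Functionals

variable {X Y : Type*} [NormedAddCommGroup X] [InnerProductSpace ℝ X]
  [NormedAddCommGroup Y] [InnerProductSpace ℝ Y]

/-- The functional `(x, y) ↦ ⟪a, x⟫`. -/
noncomputable def fstDual (Y : Type*) [NormedAddCommGroup Y] [InnerProductSpace ℝ Y] (a : X) :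
    StrongDual ℝ (X × Y) :=
  (innerSL ℝ a).comp (ContinuousLinearMap.fst ℝ X Y)

/-- The functional `(x, y) ↦ ⟪b, y⟫`. -/
noncomputable def sndDual (X : Type*) [NormedAddCommGroup X] [InnerProductSpace ℝ X] (b : Y) :
    StrongDual ℝ (X × Y) :=
  (innerSL ℝ b).comp (ContinuousLinearMap.snd ℝ X Y)

@[simp] lemma fstDual_apply (a : X) (z : X × Y) : fstDual Y a z = inner ℝ a z.1 := rfl

@[simp] lemma sndDual_apply (b : Y) (z : X × Y) : sndDual X b z = inner ℝ b z.2 := rfl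

end Functionals

variable {X Y : Type*}
  [NormedAddCommGroup X] [InnerProductSpace ℝ X] [FiniteDimensional ℝ X] [MeasurableSpace X]
  [BorelSpace X]
  [NormedAddCommGroup Y] [InnerProductSpace ℝ Y] [FiniteDimensional ℝ Y] [MeasurableSpace Y]
  [BorelSpace Y]

section Difference

variable {Z : Type*} [NormedAddCommGroup Z] [NormedSpace ℝ Z] [FiniteDimensional ℝ Z]
  [MeasurableSpace Z] [BorelSpace Z] (γ : Measure Z) [IsGaussian γ]

/-- The law of `z - z'` for independent `z`, `z'` of law `γ`. -/
noncomputable def differenceLaw {Z : Type*} [NormedAddCommGroup Z] [MeasurableSpace Z]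
    (γ : Measure Z) : Measure Z :=
  (γ.prod γ).map fun p => p.1 - p.2

instance isGaussian_differenceLaw : IsGaussian (differenceLaw γ) :=
  inferInstanceAs (IsGaussian ((γ.prod γ).map
    (ContinuousLinearMap.fst ℝ Z Z - ContinuousLinearMap.snd ℝ Z Z)))

/-- Expanding the product, the two diagonal terms each give the second moment and, by independence,
the two mixed terms each give the product of the means. -/
lemma integral_mul_differenceLaw (L M : StrongDual ℝ Z) :
    ∫ z, L z * M z ∂(differenceLaw γ) = 2 * cov[L, M; γ] := by
  have hL := IsGaussian.memLp_dual γ L 2 (by norm_num)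
  have hM := IsGaussian.memLp_dual γ M 2 (by norm_num)
  have iL := IsGaussian.integrable_dual γ L
  have iM := IsGaussian.integrable_dual γ M
  have iLM : Integrable (fun z => L z * M z) γ := integrable_dual_mul L M
  rw [differenceLaw, integral_map (by fun_prop) (by fun_prop), covariance_eq_sub hL hM]
  have e : ∀ p : Z × Z, L (p.1 - p.2) * M (p.1 - p.2) =
      L p.1 * M p.1 + L p.2 * M p.2 - L p.1 * M p.2 - M p.1 * L p.2 := by
    intro p; simp only [map_sub]; ring
  simp_rw [e]
  have i1 : Integrable (fun p : Z × Z => L p.1 * M p.1) (γ.prod γ) := iLM.comp_fst γ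
  have i2 : Integrable (fun p : Z × Z => L p.2 * M p.2) (γ.prod γ) := iLM.comp_snd γ
  rw [integral_sub, integral_sub, integral_add i1 i2, integral_prod_mul, integral_prod_mul]
  · rw [integral_fun_fst (f := fun z => L z * M z), integral_fun_snd (f := fun z => L z * M z)]
    simp
    ring
  · exact i1.add i2
  · exact iL.mul_prod iM
  · exact (i1.add i2).sub (iL.mul_prod iM)
  · exact iM.mul_prod iL

lemma integral_dual_differenceLaw (L : StrongDual ℝ Z) : (differenceLaw γ)[L] = 0 := by
  have iL := IsGaussian.integrable_dual γ L
  rw [differenceLaw, integral_map (by fun_prop) (by fun_prop)]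
  simp only [map_sub]
  rw [integral_sub (iL.comp_fst γ) (iL.comp_snd γ), integral_fun_fst (f := fun z => L z),
    integral_fun_snd (f := fun z => L z), sub_self]

end Difference

/-- The cost of a Gaussian plan is an explicit function of its covariances in orthonormal bases. -/
lemma gwCost_eq {ι κ : Type*} [Fintype ι] [Fintype κ] (u : OrthonormalBasis ι ℝ X)
    (v : OrthonormalBasis κ ℝ Y) (γ : Measure (X × Y)) [IsGaussian γ] :
    gwCost γ = ENNReal.ofReal (4 * (∑ i, cov[fstDual Y (u i), fstDual Y (u i); γ] -
      ∑ j, cov[sndDual X (v j), sndDual X (v j); γ]) ^ 2 +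
      8 * (∑ i, ∑ i', cov[fstDual Y (u i), fstDual Y (u i'); γ] ^ 2 +
        ∑ j, ∑ j', cov[sndDual X (v j), sndDual X (v j'); γ] ^ 2 -
        2 * ∑ i, ∑ j, cov[fstDual Y (u i), sndDual X (v j); γ] ^ 2)) := by
  -- The signature of ‖x‖² - ‖y‖²; the products ε i ε j put the minus sign on the cross-covariances.
  let ε : ι ⊕ κ → ℝ := Sum.elim (fun _ => 1) (fun _ => -1)
  let L : ι ⊕ κ → StrongDual ℝ (X × Y) :=
    Sum.elim (fun i => fstDual Y (u i)) (fun j => sndDual X (v j))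
  have hq : ∀ w : X × Y, ‖w.1‖ ^ 2 - ‖w.2‖ ^ 2 = ∑ i, ε i * L i w ^ 2 := by
    intro w
    simp [ε, L, Fintype.sum_sum_type, u.sum_sq_inner_right, v.sum_sq_inner_right, sub_eq_add_neg]
  obtain ⟨hi, he⟩ := integral_sq_sum_sq_of_isGaussian (integral_dual_differenceLaw γ) ε L
  have h1 : gwCost γ = ∫⁻ w, ENNReal.ofReal ((∑ i, ε i * L i w ^ 2) ^ 2) ∂(differenceLaw γ) := by
    rw [differenceLaw, lintegral_map (by fun_prop) (by fun_prop), lintegral_prod _ (by fun_prop)]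
    simp_rw [← hq]
    rfl
  rw [h1, ← ofReal_integral_eq_lintegral_ofReal hi (.of_forall fun _ => sq_nonneg _), he]
  congr 1
  simp only [integral_mul_differenceLaw, Fintype.sum_sum_type, ε, L, Sum.elim_inl, Sum.elim_inr,
    one_mul, neg_mul, mul_neg, mul_pow, Finset.sum_neg_distrib, ← Finset.mul_sum,
    Finset.sum_add_distrib]
  rw [Finset.sum_comm (f := fun (j : κ) (i : ι) => cov[sndDual X (v j), fstDual Y (u i); γ] ^ 2)]
  simp_rw [covariance_comm (sndDual X (v _)) (fstDual Y (u _))]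
  ring

omit [FiniteDimensional ℝ Y] [BorelSpace Y] in
lemma IsCoupling.cov_fst {μ : Measure X} {ν : Measure Y} {γ : Measure (X × Y)}
    (h : IsCoupling μ ν γ) (a a' : X) :
    cov[fstDual Y a, fstDual Y a'; γ] = cov[fun x => inner ℝ a x, fun x => inner ℝ a' x; μ] := by
  rw [← h.1, covariance_map_fun (by fun_prop) (by fun_prop) (by fun_prop)]
  rfl

omit [FiniteDimensional ℝ X] [BorelSpace X] in
lemma IsCoupling.cov_snd {μ : Measure X} {ν : Measure Y} {γ : Measure (X × Y)}
    (h : IsCoupling μ ν γ) (b b' : Y) :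
    cov[sndDual X b, sndDual X b'; γ] = cov[fun y => inner ℝ b y, fun y => inner ℝ b' y; ν] := by
  rw [← h.2, covariance_map_fun (by fun_prop) (by fun_prop) (by fun_prop)]
  rfl

/-- Among Gaussian couplings, a larger cross-covariance gives a smaller cost. -/
lemma gwCost_le_of_sum_sq_cov_le {ι κ : Type*} [Fintype ι] [Fintype κ]
    (u : OrthonormalBasis ι ℝ X) (v : OrthonormalBasis κ ℝ Y) {μ : Measure X} {ν : Measure Y}
    {γ γ' : Measure (X × Y)} [IsGaussian γ] [IsGaussian γ']
    (h : IsCoupling μ ν γ) (h' : IsCoupling μ ν γ')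
    (hle : ∑ i, ∑ j, cov[fstDual Y (u i), sndDual X (v j); γ'] ^ 2 ≤
      ∑ i, ∑ j, cov[fstDual Y (u i), sndDual X (v j); γ] ^ 2) :
    gwCost γ ≤ gwCost γ' := by
  rw [gwCost_eq u v γ, gwCost_eq u v γ']
  -- Both plans have the same covariances within each factor, so only the cross terms remain to be
  -- compared.
  simp only [h.cov_fst, h.cov_snd, h'.cov_fst, h'.cov_snd]
  apply ENNReal.ofReal_le_ofReal
  linarith

end Cost

/-! ### Upper bound on the cross-covariance by a rearrangement inequality. -/

section Rearrangement

/-- Optimal potentials for the linear program behind the rearrangement inequality. -/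
lemma exists_rearrangement_potentials {d e : ℕ → ℝ} (hd : Antitone d) (he : Antitone e)
    (hd0 : ∀ i, 0 ≤ d i) (he0 : ∀ i, 0 ≤ e i) {N : ℕ} (hN : d N = 0) :
    ∃ u v : ℕ → ℝ, (∀ i, 0 ≤ u i) ∧ (∀ i, 0 ≤ v i) ∧
      (∀ i < N, ∀ j < N, d i * e j ≤ u i + v j) ∧ ∀ i < N, u i + v i = d i * e i := by
  -- Summation by parts: f l + g l = d l e l - d (l + 1) e (l + 1). The potentials are the tail sums
  -- of f and g, and `hN` removes the boundary term of the telescoping.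
  let f : ℕ → ℝ := fun l => (d l - d (l + 1)) * e l
  let g : ℕ → ℝ := fun l => (e l - e (l + 1)) * d (l + 1)
  have hd1 : ∀ l, d (l + 1) ≤ d l := fun l => hd (Nat.le_succ l)
  have he1 : ∀ l, e (l + 1) ≤ e l := fun l => he (Nat.le_succ l)
  have hdiag : ∀ i < N, ∑ l ∈ Finset.Ico i N, f l + ∑ l ∈ Finset.Ico i N, g l = d i * e i := by
    intro i hi
    rw [← Finset.sum_add_distrib]
    have : ∀ l, f l + g l = -(d (l + 1) * e (l + 1) - d l * e l) := fun l => by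
      simp only [f, g]; ring
    simp only [this, Finset.sum_neg_distrib]
    rw [Finset.sum_Ico_sub (fun l => d l * e l) hi.le, hN]
    ring
  refine ⟨fun i => ∑ l ∈ Finset.Ico i N, f l, fun j => ∑ l ∈ Finset.Ico j N, g l,
    fun i => Finset.sum_nonneg fun l _ => mul_nonneg (sub_nonneg.2 (hd1 l)) (he0 l),
    fun i => Finset.sum_nonneg fun l _ => mul_nonneg (sub_nonneg.2 (he1 l)) (hd0 _),
    fun i hi j hj => ?_, hdiag⟩
  -- The constraint at (i, j) follows from the equality at the larger index: between the two
  -- indices, one potential grows at least as fast as d · e j (if i ≤ j) or e · d i (if j ≤ i). The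
  -- index l + 1 in g still satisfies l + 1 ≤ i in the second case.
  rcases le_total i j with hij | hij
  · have h1 : (d i - d j) * e j ≤ ∑ l ∈ Finset.Ico i j, f l := by
      have := Finset.sum_Ico_sub (fun l => -d l * e j) hij
      calc (d i - d j) * e j = ∑ l ∈ Finset.Ico i j, (d l - d (l + 1)) * e j := by
            rw [← Finset.sum_congr rfl fun l _ => (by ring :
              -d (l + 1) * e j - -d l * e j = (d l - d (l + 1)) * e j), this]
            ring
        _ ≤ _ := Finset.sum_le_sum fun l hl => mul_le_mul_of_nonneg_left
            (he (Finset.mem_Ico.1 hl).2.le) (sub_nonneg.2 (hd1 l))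
    have h2 := Finset.sum_Ico_consecutive f hij hj.le
    have h3 := hdiag j hj
    simp only
    linarith
  · have h1 : (e j - e i) * d i ≤ ∑ l ∈ Finset.Ico j i, g l := by
      have := Finset.sum_Ico_sub (fun l => -e l * d i) hij
      calc (e j - e i) * d i = ∑ l ∈ Finset.Ico j i, (e l - e (l + 1)) * d i := by
            rw [← Finset.sum_congr rfl fun l _ => (by ring :
              -e (l + 1) * d i - -e l * d i = (e l - e (l + 1)) * d i), this]
            ring
        _ ≤ _ := Finset.sum_le_sum fun l hl => mul_le_mul_of_nonneg_left
            (hd (Finset.mem_Ico.1 hl).2) (sub_nonneg.2 (he1 l))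
    have h2 := Finset.sum_Ico_consecutive g hij hi.le
    have h3 := hdiag i hi
    simp only
    linarith

/-- A sequence indexed by `Fin n`, extended by `0`. -/
noncomputable def extendZero {n : ℕ} (d : Fin n → ℝ) (l : ℕ) : ℝ :=
  if h : l < n then d ⟨l, h⟩ else 0

@[simp] lemma extendZero_val {n : ℕ} (d : Fin n → ℝ) (i : Fin n) : extendZero d i = d i := by
  simp [extendZero]

lemma extendZero_nonneg {n : ℕ} {d : Fin n → ℝ} (hd : ∀ i, 0 ≤ d i) (l : ℕ) :
    0 ≤ extendZero d l := by
  unfold extendZero; split_ifs <;> simp [hd]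

lemma antitone_extendZero {n : ℕ} {d : Fin n → ℝ} (hd : Antitone d) (hd0 : ∀ i, 0 ≤ d i) :
    Antitone (extendZero d) := by
  intro a b hab
  by_cases hb : b < n
  · simp only [extendZero, hb, hab.trans_lt hb, dif_pos]
    exact hd hab
  · simp only [extendZero, hb, dif_neg, not_false_eq_true]
    exact extendZero_nonneg hd0 a

/-- Weak duality: potentials dominating d i e j, summed against substochastic weights, bound the
left side by their total. Extending e by zero reduces the rectangular case to the square one. -/
lemma sum_mul_le_of_substochastic {m n : ℕ} (hnm : n ≤ m) {d : Fin m → ℝ} {e : Fin n → ℝ}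
    (hd : Antitone d) (he : Antitone e) (hd0 : ∀ i, 0 ≤ d i) (he0 : ∀ j, 0 ≤ e j)
    {M : Fin m → Fin n → ℝ} (hM : ∀ i j, 0 ≤ M i j) (hrow : ∀ i, ∑ j, M i j ≤ 1)
    (hcol : ∀ j, ∑ i, M i j ≤ 1) :
    ∑ i, ∑ j, M i j * (d i * e j) ≤ ∑ j, d (Fin.castLE hnm j) * e j := by
  obtain ⟨u, v, hu, hv, hle, heq⟩ := exists_rearrangement_potentials (antitone_extendZero hd hd0)
    (antitone_extendZero he he0) (extendZero_nonneg hd0) (extendZero_nonneg he0) (N := m)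
    (by simp [extendZero])
  calc ∑ i, ∑ j, M i j * (d i * e j) ≤ ∑ i : Fin m, ∑ j : Fin n, M i j * (u i + v j) :=
        Finset.sum_le_sum fun i _ => Finset.sum_le_sum fun j _ =>
          mul_le_mul_of_nonneg_left (by simpa using hle i i.2 j (j.2.trans_le hnm)) (hM i j)
    _ = ∑ i : Fin m, (∑ j, M i j) * u i + ∑ j : Fin n, (∑ i, M i j) * v j := by
        simp_rw [mul_add, Finset.sum_add_distrib, Finset.sum_mul]
        congr 1
        exact Finset.sum_comm
    _ ≤ ∑ i : Fin m, u i + ∑ j : Fin n, v j :=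
        add_le_add (Finset.sum_le_sum fun i _ => mul_le_of_le_one_left (hu i) (hrow i))
          (Finset.sum_le_sum fun j _ => mul_le_of_le_one_left (hv j) (hcol j))
    -- Nonnegativity of v allows completing its sum to m terms, so that u and v pair up on the
    -- diagonal.
    _ ≤ ∑ i : Fin m, u i + ∑ i : Fin m, v i := by
        gcongr
        rw [Fin.sum_univ_eq_sum_range, Fin.sum_univ_eq_sum_range]
        exact Finset.sum_le_sum_of_subset_of_nonneg (by simpa using hnm) fun i _ _ => hv i
    _ = ∑ i : Fin m, d i * extendZero e i := by
        rw [← Finset.sum_add_distrib]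
        exact Finset.sum_congr rfl fun i _ => by simpa using heq i i.2
    _ = ∑ j, d (Fin.castLE hnm j) * e j := by
        have h1 : ∀ i : Fin m, d i * extendZero e i = extendZero d i * extendZero e i := by simp
        have h2 : ∀ j : Fin n, d (Fin.castLE hnm j) * e j = extendZero d j * extendZero e j := by
          intro j
          rw [extendZero_val, ← extendZero_val d]
          rfl
        simp only [h1, h2]
        rw [Fin.sum_univ_eq_sum_range (fun l => extendZero d l * extendZero e l) m,
          Fin.sum_univ_eq_sum_range (fun l => extendZero d l * extendZero e l) n]
        refine (Finset.sum_subset (by simpa using hnm) fun l _ hl => ?_).symm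
        have : extendZero e l = 0 := by
          simp only [Finset.mem_range] at hl; simp [extendZero, hl]
        rw [this, mul_zero]

section Semidefinite

variable {ι κ : Type*} [Fintype ι] [Fintype κ] {d : ι → ℝ} {e : κ → ℝ} {K : ι → κ → ℝ}

/-- Rows of the cross-covariance in a positive semidefinite block form with diagonal blocks. -/
lemma sum_sq_div_le_of_semidefinite
    (h : ∀ (a : ι → ℝ) (b : κ → ℝ), 0 ≤ ∑ i, d i * a i ^ 2 + ∑ j, e j * b j ^ 2 +
      2 * ∑ i, ∑ j, a i * b j * K i j) (i : ι) :
    ∑ j, K i j ^ 2 / e j ≤ d i := by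
  classical
  set Q := ∑ j, K i j ^ 2 / e j with hQ
  -- The second argument minimizes the form in b when e > 0, giving the Schur complement. Where e j
  -- = 0 the quotient is 0 by convention and the term drops out on both sides.
  have h1 := h (Pi.single i 1) (fun j => -(K i j / e j))
  have e1 : ∑ i', d i' * (Pi.single i 1 : ι → ℝ) i' ^ 2 = d i := by
    rw [Finset.sum_eq_single i] <;> simp +contextual
  have e2 : ∑ j, e j * (-(K i j / e j)) ^ 2 = Q := by
    rw [hQ]
    refine Finset.sum_congr rfl fun j _ => ?_
    by_cases hj : e j = 0
    · simp [hj]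
    · field_simp
  have e3 : ∑ i', ∑ j, (Pi.single i 1 : ι → ℝ) i' * -(K i j / e j) * K i' j = -Q := by
    rw [Finset.sum_eq_single i]
    · rw [hQ, ← Finset.sum_neg_distrib]
      refine Finset.sum_congr rfl fun j _ => ?_
      simp
      ring
    · simp +contextual
    · simp
  rw [e1, e2, e3] at h1
  linarith

/-- Nonnegativity of a 2 × 2 principal minor. It forces K i j = 0 where d i e j = 0, which makes the
later division by d i e j harmless. -/
lemma sq_le_mul_of_semidefinite
    (h : ∀ (a : ι → ℝ) (b : κ → ℝ), 0 ≤ ∑ i, d i * a i ^ 2 + ∑ j, e j * b j ^ 2 +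
      2 * ∑ i, ∑ j, a i * b j * K i j) (i : ι) (j : κ) :
    K i j ^ 2 ≤ d i * e j := by
  classical
  have key : ∀ t s : ℝ, 0 ≤ d i * t ^ 2 + e j * s ^ 2 + 2 * (t * s * K i j) := by
    intro t s
    have h1 := h (Pi.single i t) (Pi.single j s)
    have e1 : ∑ i', d i' * (Pi.single i t : ι → ℝ) i' ^ 2 = d i * t ^ 2 := by
      rw [Finset.sum_eq_single i] <;> simp +contextual
    have e2 : ∑ j', e j' * (Pi.single j s : κ → ℝ) j' ^ 2 = e j * s ^ 2 := by
      rw [Finset.sum_eq_single j] <;> simp +contextual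
    have e3 : ∑ i', ∑ j', (Pi.single i t : ι → ℝ) i' * (Pi.single j s : κ → ℝ) j' * K i' j' =
        t * s * K i j := by
      rw [Finset.sum_eq_single i, Finset.sum_eq_single j] <;> simp +contextual
    rwa [e1, e2, e3] at h1
  have := discrim_le_zero (a := d i) (b := 2 * K i j) (c := e j) fun t => by
    have := key t 1
    linarith
  simp only [discrim] at this
  linarith

end Semidefinite

/-- The maximal squared cross-covariance given diagonal covariances. -/
lemma sum_sq_le_of_semidefinite {m n : ℕ} (hnm : n ≤ m) {d : Fin m → ℝ} {e : Fin n → ℝ}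
    (hd : Antitone d) (he : Antitone e) (hd0 : ∀ i, 0 ≤ d i) (he0 : ∀ j, 0 ≤ e j)
    {K : Fin m → Fin n → ℝ}
    (h : ∀ (a : Fin m → ℝ) (b : Fin n → ℝ), 0 ≤ ∑ i, d i * a i ^ 2 + ∑ j, e j * b j ^ 2 +
      2 * ∑ i, ∑ j, a i * b j * K i j) :
    ∑ i, ∑ j, K i j ^ 2 ≤ ∑ j, d (Fin.castLE hnm j) * e j := by
  have h' : ∀ (b : Fin n → ℝ) (a : Fin m → ℝ), 0 ≤ ∑ j, e j * b j ^ 2 + ∑ i, d i * a i ^ 2 +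
      2 * ∑ j, ∑ i, b j * a i * K i j := by
    intro b a
    have := h a b
    rw [Finset.sum_comm] at this
    simp_rw [mul_comm (a _) (b _)] at this
    linarith
  have hK := sq_le_mul_of_semidefinite h
  refine le_trans (le_of_eq ?_) (sum_mul_le_of_substochastic hnm hd he hd0 he0
    (M := fun i j => K i j ^ 2 / (d i * e j))
    (fun i j => div_nonneg (sq_nonneg _) (mul_nonneg (hd0 i) (he0 j))) (fun i => ?_) fun j => ?_)
  · refine Finset.sum_congr rfl fun i _ => Finset.sum_congr rfl fun j _ => ?_
    by_cases hz : d i * e j = 0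
    · have := hK i j
      rw [hz] at this
      rw [hz, mul_zero]
      exact le_antisymm this (sq_nonneg _)
    · rw [div_mul_cancel₀ _ hz]
  · simp_rw [mul_comm (d i), ← div_div, ← Finset.sum_div]
    exact div_le_one_of_le₀ (sum_sq_div_le_of_semidefinite h i) (hd0 i)
  · simp_rw [← div_div, ← Finset.sum_div]
    exact div_le_one_of_le₀ (sum_sq_div_le_of_semidefinite h' j) (he0 j)

end Rearrangement

/-! ### Linear images of Gaussians and graph couplings. -/

section LinearImages

variable {m n : ℕ}

lemma measurable_toEuclideanLin (T : Matrix (Fin n) (Fin m) ℝ) : Measurable T.toEuclideanLin :=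
  (LinearMap.toContinuousLinearMap T.toEuclideanLin).continuous.measurable

lemma inner_toEuclideanLin_right (T : Matrix (Fin n) (Fin m) ℝ) (y : EuclideanSpace ℝ (Fin n))
    (x : EuclideanSpace ℝ (Fin m)) :
    inner ℝ y (T.toEuclideanLin x) = inner ℝ (Tᵀ.toEuclideanLin y) x := by
  rw [← Matrix.conjTranspose_eq_transpose_of_trivial,
    Matrix.toEuclideanLin_conjTranspose_eq_adjoint, LinearMap.adjoint_inner_left]

lemma posSemidef_mul_mul_transpose {S : Matrix (Fin m) (Fin m) ℝ} (hS : S.PosSemidef)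
    (T : Matrix (Fin n) (Fin m) ℝ) : (T * S * Tᵀ).PosSemidef := by
  simpa using hS.mul_mul_conjTranspose_same T

lemma cov_inner_multivariateGaussian {S : Matrix (Fin m) (Fin m) ℝ} (hS : S.PosSemidef)
    (a x y : EuclideanSpace ℝ (Fin m)) :
    cov[fun z => inner ℝ x z, fun z => inner ℝ y z; multivariateGaussian a S] =
      x.ofLp ⬝ᵥ S *ᵥ y.ofLp := by
  rw [← covarianceBilin_apply_eq_cov IsGaussian.memLp_two_id,
    covarianceBilin_multivariateGaussian hS]

lemma map_toEuclideanLin_multivariateGaussian {S : Matrix (Fin m) (Fin m) ℝ} (hS : S.PosSemidef)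
    (T : Matrix (Fin n) (Fin m) ℝ) :
    (multivariateGaussian 0 S).map T.toEuclideanLin = multivariateGaussian 0 (T * S * Tᵀ) := by
  apply Measure.ext_of_charFun
  ext t
  rw [charFun_multivariateGaussian (posSemidef_mul_mul_transpose hS T), charFun_apply,
    integral_map (measurable_toEuclideanLin T).aemeasurable (by fun_prop)]
  simp_rw [real_inner_comm t, inner_toEuclideanLin_right, real_inner_comm _ (Tᵀ.toEuclideanLin t)]
  rw [← charFun_apply, charFun_multivariateGaussian hS]
  congr 2
  · simp
  · congr 2
    simp [← Matrix.mulVec_mulVec, Matrix.dotProduct_mulVec, Matrix.mulVec_transpose]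

lemma eq_of_multivariateGaussian_eq {S S' : Matrix (Fin m) (Fin m) ℝ} (hS : S.PosSemidef)
    (hS' : S'.PosSemidef) {a : EuclideanSpace ℝ (Fin m)}
    (h : multivariateGaussian a S = multivariateGaussian a S') : S = S' := by
  ext i j
  rw [← covariance_eval_multivariateGaussian (μ := a) hS, h,
    covariance_eval_multivariateGaussian hS']

/-- The graph of a map is a coupling as soon as the map transports `μ` to `ν`. -/
lemma isCoupling_graph_iff {X Y : Type*} [MeasurableSpace X] [MeasurableSpace Y] {μ : Measure X}
    {ν : Measure Y} {T : X → Y} (hT : Measurable T) :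
    IsCoupling μ ν (μ.map fun x => (x, T x)) ↔ μ.map T = ν := by
  rw [IsCoupling, Measure.map_map (by fun_prop) (by fun_prop),
    Measure.map_map (by fun_prop) (by fun_prop)]
  simp [Function.comp_def]

/-- The covariance of the image of a Gaussian under an optimal linear map. -/
lemma IsGGWMatrix.mul_mul_transpose {S : Matrix (Fin m) (Fin m) ℝ} {L : Matrix (Fin n) (Fin n) ℝ}
    {T : Matrix (Fin n) (Fin m) ℝ} (h : IsGGWMatrix S L T) (hS : S.PosSemidef)
    (hL : L.PosSemidef) : T * S * Tᵀ = L :=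
  eq_of_multivariateGaussian_eq (posSemidef_mul_mul_transpose hS T) hL
    ((map_toEuclideanLin_multivariateGaussian hS T).symm.trans
      ((isCoupling_graph_iff h.1).1 h.2.1.1))

end LinearImages

/-! ### Existence and optimality of maps of spectral form. -/

section Spectral

variable {m n : ℕ}

lemma exists_orthonormalBasis_of_card {V ι : Type*} [NormedAddCommGroup V] [InnerProductSpace ℝ V]
    [FiniteDimensional ℝ V] [Fintype ι] {v : ι → V} (hv : Orthonormal ℝ v)
    (h : Fintype.card ι = Module.finrank ℝ V) : ∃ b : OrthonormalBasis ι ℝ V, ∀ i, b i = v i :=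
  ⟨OrthonormalBasis.mk hv (hv.linearIndependent.span_eq_top_of_card_eq_finrank' h).ge,
    fun i => by simp⟩

/-- The columns of an orthogonal matrix form an orthonormal basis. -/
lemma exists_columnBasis {P : Matrix (Fin m) (Fin m) ℝ}
    (hP : P ∈ Matrix.orthogonalGroup (Fin m) ℝ) :
    ∃ u : OrthonormalBasis (Fin m) ℝ (EuclideanSpace ℝ (Fin m)), ∀ i, (u i).ofLp = Pᵀ i := by
  have hon : Orthonormal ℝ fun i : Fin m => (WithLp.toLp 2 (Pᵀ i) : EuclideanSpace ℝ (Fin m)) := by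
    rw [orthonormal_iff_ite]
    intro i j
    have := congrFun (congrFun ((Matrix.mem_orthogonalGroup_iff' _ _).1 hP) i) j
    rw [Matrix.one_apply] at this
    rw [← this]
    simp [PiLp.inner_apply, Matrix.mul_apply, mul_comm]
  obtain ⟨u, hu⟩ := exists_orthonormalBasis_of_card hon (by simp)
  exact ⟨u, fun i => by rw [hu]⟩

lemma exists_antitone_diagonalization {S : Matrix (Fin m) (Fin m) ℝ} (hS : S.IsHermitian) :
    ∃ (P : Matrix (Fin m) (Fin m) ℝ) (d : Fin m → ℝ),
      P ∈ Matrix.orthogonalGroup (Fin m) ℝ ∧ Antitone d ∧ S = P * Matrix.diagonal d * Pᵀ := by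
  let U : Matrix (Fin m) (Fin m) ℝ := hS.eigenvectorUnitary
  have hU : Uᵀ * U = 1 :=
    (Matrix.mem_orthogonalGroup_iff' _ _).1 hS.eigenvectorUnitary.2
  have hSU : S = U * Matrix.diagonal hS.eigenvalues * Uᵀ := hS.spectral_theorem
  -- Sorting the negated eigenvalues in increasing order puts the eigenvalues in nonincreasing
  -- order.
  let σ := Tuple.sort fun i => -hS.eigenvalues i
  refine ⟨U.submatrix id σ, hS.eigenvalues ∘ σ, (Matrix.mem_orthogonalGroup_iff' _ _).2 ?_, ?_, ?_⟩
  · have := Matrix.submatrix_mul_equiv Uᵀ U σ (Equiv.refl _) σ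
    rwa [hU, Matrix.submatrix_one_equiv] at this
  · intro i j hij
    have := Tuple.monotone_sort (fun i => -hS.eigenvalues i) hij
    exact neg_le_neg_iff.1 this
  · rw [← Matrix.submatrix_diagonal_equiv, Matrix.transpose_submatrix,
      Matrix.submatrix_mul_equiv, Matrix.submatrix_mul_equiv]
    simpa using hSU

lemma exists_isSpectralMap {S : Matrix (Fin m) (Fin m) ℝ} {L : Matrix (Fin n) (Fin n) ℝ}
    (hS : S.PosDef) (hL : L.PosSemidef) : ∃ T, IsSpectralMap S L T := by
  obtain ⟨P, d, hP, hd, hSP⟩ := exists_antitone_diagonalization hS.isHermitian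
  obtain ⟨Q, e, hQ, he, hLQ⟩ := exists_antitone_diagonalization hL.isHermitian
  have hPP : Pᵀ * P = 1 := (Matrix.mem_orthogonalGroup_iff' _ _).1 hP
  have hdpos : (Matrix.diagonal d).PosDef := by
    have h1 : Matrix.diagonal d = Pᴴ * S * P := by
      rw [hSP, Matrix.conjTranspose_eq_transpose_of_trivial]
      simp only [← Matrix.mul_assoc, hPP, Matrix.one_mul]
      rw [Matrix.mul_assoc, hPP, Matrix.mul_one]
    rw [h1]
    exact hS.conjTranspose_mul_mul_same (Matrix.mulVec_injective_of_isUnit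
      ⟨⟨P, Pᵀ, (Matrix.mem_orthogonalGroup_iff _ _).1 hP, hPP⟩, rfl⟩)
  exact ⟨_, P, d, Q, e, fun _ => 1, hP, hd, hSP, hQ, he, hLQ,
    fun j _ => Matrix.posDef_diagonal_iff.1 hdpos j, fun _ => Or.inl rfl, rfl⟩

lemma columns_dotProduct_mulVec (P : Matrix (Fin m) (Fin m) ℝ) (M : Matrix (Fin m) (Fin n) ℝ)
    (Q : Matrix (Fin n) (Fin n) ℝ) (i : Fin m) (j : Fin n) :
    Pᵀ i ⬝ᵥ M *ᵥ Qᵀ j = (Pᵀ * M * Q) i j := by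
  rw [Matrix.mul_assoc]
  rfl

/-- Maps of spectral form are optimal. -/
theorem IsSpectralMap.isGGWMatrix (hnm : n ≤ m) {S : Matrix (Fin m) (Fin m) ℝ}
    {L : Matrix (Fin n) (Fin n) ℝ} {T : Matrix (Fin n) (Fin m) ℝ} (hS : S.PosSemidef)
    (hL : L.PosSemidef) (hT : IsSpectralMap S L T) : IsGGWMatrix S L T := by
  obtain ⟨P, d, Q, e, ε, hP, hd, hSP, hQ, he, hLQ, hpos, hε, hTA⟩ := hT
  set A : Matrix (Fin n) (Fin m) ℝ := Matrix.of fun (i : Fin n) (j : Fin m) =>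
      if (i : ℕ) = (j : ℕ) then ε i * √(e i) * (√(d j))⁻¹ else 0 with hA
  have hPP : Pᵀ * P = 1 := (Matrix.mem_orthogonalGroup_iff' _ _).1 hP
  have hQQ : Qᵀ * Q = 1 := (Matrix.mem_orthogonalGroup_iff' _ _).1 hQ
  have hSd : Pᵀ * S * P = Matrix.diagonal d := by
    rw [hSP]
    simp only [← Matrix.mul_assoc, hPP, Matrix.one_mul]
    rw [Matrix.mul_assoc, hPP, Matrix.mul_one]
  have hLe : Qᵀ * L * Q = Matrix.diagonal e := by
    rw [hLQ]
    simp only [← Matrix.mul_assoc, hQQ, Matrix.one_mul]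
    rw [Matrix.mul_assoc, hQQ, Matrix.mul_one]
  have hd0 : ∀ i, 0 ≤ d i := Matrix.posSemidef_diagonal_iff.1 (by
    rw [← hSd]; simpa using hS.conjTranspose_mul_mul_same P)
  have he0 : ∀ j, 0 ≤ e j := Matrix.posSemidef_diagonal_iff.1 (by
    rw [← hLe]; simpa using hL.conjTranspose_mul_mul_same Q)
  have hεsq : ∀ j, ε j ^ 2 = 1 := fun j => by rcases hε j with h | h <;> simp [h]
  -- This matrix is the cross-covariance of the graph plan in the eigenbases. The cancellation d i ·
  -- d i^{-1/2} needs d i > 0 only for i < n, which equality of the indices guarantees.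
  have hdA : ∀ i j, (Matrix.diagonal d * Aᵀ) i j = if (j : ℕ) = (i : ℕ) then
      ε j * √(e j) * √(d i) else 0 := by
    intro i j
    rw [Matrix.diagonal_mul, Matrix.transpose_apply, hA, Matrix.of_apply]
    split_ifs with h
    · have : 0 < d i := hpos i (h ▸ j.2)
      have h2 : √(d i) ≠ 0 := (Real.sqrt_pos.2 this).ne'
      nth_rewrite 1 [← Real.mul_self_sqrt (hd0 i)]
      field_simp
    · simp
  have hAdA : A * (Matrix.diagonal d * Aᵀ) = Matrix.diagonal e := by
    ext j j'
    rw [Matrix.mul_apply, Finset.sum_eq_single (Fin.castLE hnm j)]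
    · have : 0 < d (Fin.castLE hnm j) := hpos _ (by simp)
      have h2 : √(d (Fin.castLE hnm j)) ≠ 0 := (Real.sqrt_pos.2 this).ne'
      rw [hdA, hA, Matrix.of_apply, Matrix.diagonal_apply]
      by_cases h : j = j'
      · subst h
        simp only [Fin.val_castLE, if_true]
        calc _ = ε j ^ 2 * (√(e j) * √(e j)) := by field_simp
          _ = e j := by rw [hεsq, Real.mul_self_sqrt (he0 j), one_mul]
      · have : ¬ (j' : ℕ) = j := fun h' => h (Fin.ext h'.symm)
        simp [h, this]
    · intro i _ hi
      have : ¬ (j : ℕ) = i := fun h => hi (Fin.ext (by simp [h]))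
      simp [hA, this]
    · simp
  have hTS : S * Tᵀ = P * (Matrix.diagonal d * Aᵀ) * Qᵀ := by
    rw [hSP, hTA]
    simp only [Matrix.transpose_mul, Matrix.transpose_transpose, Matrix.mul_assoc]
    rw [← Matrix.mul_assoc Pᵀ P, hPP, Matrix.one_mul]
  have hTST : T * S * Tᵀ = L := by
    rw [Matrix.mul_assoc, hTS, hTA, hLQ, ← hAdA]
    simp only [Matrix.mul_assoc]
    rw [← Matrix.mul_assoc Pᵀ P, hPP, Matrix.one_mul]
  have hTm := measurable_toEuclideanLin T
  have hcpl : IsCoupling (multivariateGaussian 0 S) (multivariateGaussian 0 L)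
      ((multivariateGaussian 0 S).map fun x => (x, T.toEuclideanLin x)) :=
    (isCoupling_graph_iff hTm).2 (by rw [map_toEuclideanLin_multivariateGaussian hS, hTST])
  have hgauss : IsGaussian
      ((multivariateGaussian 0 S).map fun x => (x, T.toEuclideanLin x)) :=
    inferInstanceAs (IsGaussian ((multivariateGaussian 0 S).map
      ((ContinuousLinearMap.id ℝ _).prod (LinearMap.toContinuousLinearMap T.toEuclideanLin))))
  refine ⟨hTm, ⟨hcpl, hgauss⟩, fun γ' hc' hg' => ?_⟩
  obtain ⟨u, hu⟩ := exists_columnBasis hP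
  obtain ⟨v, hv⟩ := exists_columnBasis hQ
  refine gwCost_le_of_sum_sq_cov_le u v hcpl hc' ?_
  have hK : ∀ i j, cov[fstDual _ (u i), sndDual _ (v j);
      (multivariateGaussian 0 S).map fun x => (x, T.toEuclideanLin x)] =
      if (j : ℕ) = (i : ℕ) then ε j * √(e j) * √(d i) else 0 := by
    intro i j
    rw [covariance_map (by fun_prop) (by fun_prop) (by fun_prop)]
    simp only [Function.comp_def, fstDual_apply, sndDual_apply, inner_toEuclideanLin_right]
    rw [cov_inner_multivariateGaussian hS, Matrix.ofLp_toLpLin, Matrix.toLin'_apply,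
      Matrix.mulVec_mulVec, hu, hv, columns_dotProduct_mulVec, hTS]
    simp only [Matrix.mul_assoc, hQQ, Matrix.mul_one]
    rw [← Matrix.mul_assoc Pᵀ P, hPP, Matrix.one_mul, hdA]
  -- The graph plan attains the rearrangement bound, so any competitor need only be shown to satisfy
  -- it.
  have hsum : ∑ i, ∑ j, cov[fstDual _ (u i), sndDual _ (v j);
      (multivariateGaussian 0 S).map fun x => (x, T.toEuclideanLin x)] ^ 2 =
      ∑ j, d (Fin.castLE hnm j) * e j := by
    rw [Finset.sum_comm]
    refine Finset.sum_congr rfl fun j _ => ?_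
    rw [Finset.sum_eq_single (Fin.castLE hnm j)]
    · rw [hK]
      simp only [Fin.val_castLE, if_true, mul_pow, hεsq, Real.sq_sqrt, hd0, he0]
      ring
    · intro i _ hi
      have : ¬ (j : ℕ) = i := fun h => hi (Fin.ext (by simp [h]))
      rw [hK, if_neg this]
      simp
    · simp
  rw [hsum]
  refine sum_sq_le_of_semidefinite hnm hd he hd0 he0 fun a b => ?_
  -- Variances of arbitrary linear functionals under the competitor express the positive
  -- semidefiniteness of its joint covariance.
  have hvar := variance_nonneg (fun z => ∑ i, a i * fstDual _ (u i) z +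
    ∑ j, b j * sndDual _ (v j) z) γ'
  have hm : ∀ M : StrongDual ℝ (EuclideanSpace ℝ (Fin m) × EuclideanSpace ℝ (Fin n)),
      MemLp M 2 γ' := fun M => IsGaussian.memLp_dual γ' M 2 (by norm_num)
  have hma : ∀ i, MemLp (fun z => a i * fstDual (EuclideanSpace ℝ (Fin n)) (u i) z) 2 γ' :=
    fun i => (hm _).const_mul _
  have hmb : ∀ j, MemLp (fun z => b j * sndDual (EuclideanSpace ℝ (Fin m)) (v j) z) 2 γ' :=
    fun j => (hm _).const_mul _
  rw [variance_fun_add (memLp_finsetSum _ fun i _ => hma i) (memLp_finsetSum _ fun j _ => hmb j),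
    ← covariance_self (memLp_finsetSum _ fun i _ => hma i).aemeasurable,
    ← covariance_self (memLp_finsetSum _ fun j _ => hmb j).aemeasurable,
    covariance_fun_sum_fun_sum hma hma, covariance_fun_sum_fun_sum hmb hmb,
    covariance_fun_sum_fun_sum hma hmb] at hvar
  simp only [covariance_const_mul_left, covariance_const_mul_right, hc'.cov_fst, hc'.cov_snd,
    cov_inner_multivariateGaussian hS, cov_inner_multivariateGaussian hL, hu, hv,
    columns_dotProduct_mulVec, hSd, hLe, Matrix.diagonal_apply, mul_ite, mul_zero,
    Finset.sum_ite_eq, Finset.mem_univ, if_true] at hvar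
  have e1 : ∀ i, a i * (a i * d i) = d i * a i ^ 2 := fun i => by ring
  have e2 : ∀ j, b j * (b j * e j) = e j * b j ^ 2 := fun j => by ring
  have e3 : ∀ i j x, b j * (a i * x) = a i * b j * x := fun i j x => by ring
  simp only [e1, e2, e3] at hvar
  linarith

end Spectral

/-! ### Invariance of optimality under affine isometries. -/

section Isometries

variable {X Y X' Y' : Type*}
  [NormedAddCommGroup X] [InnerProductSpace ℝ X] [FiniteDimensional ℝ X] [MeasurableSpace X]
  [BorelSpace X]
  [NormedAddCommGroup Y] [InnerProductSpace ℝ Y] [FiniteDimensional ℝ Y] [MeasurableSpace Y]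
  [BorelSpace Y]
  [NormedAddCommGroup X'] [InnerProductSpace ℝ X'] [FiniteDimensional ℝ X'] [MeasurableSpace X']
  [BorelSpace X']
  [NormedAddCommGroup Y'] [InnerProductSpace ℝ Y'] [FiniteDimensional ℝ Y'] [MeasurableSpace Y']
  [BorelSpace Y']

omit [FiniteDimensional ℝ X] [FiniteDimensional ℝ Y] in
lemma gwCost_map (f : X ≃ᵃⁱ[ℝ] X') (g : Y ≃ᵃⁱ[ℝ] Y') (γ : Measure (X × Y)) [SFinite γ] :
    gwCost (γ.map (Prod.map f g)) = gwCost γ := by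
  have hf : Measurable f := f.continuous.measurable
  have hg : Measurable g := g.continuous.measurable
  have hm : Measurable fun p : (X' × Y') × (X' × Y') =>
      ENNReal.ofReal ((‖p.1.1 - p.2.1‖ ^ 2 - ‖p.1.2 - p.2.2‖ ^ 2) ^ 2) := by fun_prop
  rw [gwCost, gwCost, lintegral_map (Measurable.lintegral_prod_right' hm) (by fun_prop)]
  refine lintegral_congr fun z => ?_
  rw [lintegral_map (by fun_prop) (by fun_prop)]
  simp only [Prod.map_fst, Prod.map_snd, ← dist_eq_norm, f.dist_map, g.dist_map]

omit [FiniteDimensional ℝ X] [FiniteDimensional ℝ X'] in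
lemma isGaussian_map_affine (f : X ≃ᵃⁱ[ℝ] X') (g : Y ≃ᵃⁱ[ℝ] Y') (γ : Measure (X × Y))
    [IsGaussian γ] : IsGaussian (γ.map (Prod.map f g)) := by
  have h : Prod.map f g = (fun z => (f 0, g 0) + z) ∘
      (f.linearIsometryEquiv.toContinuousLinearEquiv.toContinuousLinearMap.prodMap
        g.linearIsometryEquiv.toContinuousLinearEquiv.toContinuousLinearMap) := by
    ext z
    · have := f.map_vadd 0 z.1
      simp at this
      simp [this, add_comm]
    · have := g.map_vadd 0 z.2
      simp at this
      simp [this, add_comm]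
  rw [h, ← Measure.map_map (by fun_prop) (by fun_prop)]
  infer_instance

lemma IsCoupling.map_prodMap {X Y X' Y' : Type*} [MeasurableSpace X] [MeasurableSpace Y]
    [MeasurableSpace X'] [MeasurableSpace Y'] {μ : Measure X} {ν : Measure Y}
    {γ : Measure (X × Y)} (h : IsCoupling μ ν γ) {f : X → X'} {g : Y → Y'} (hf : Measurable f)
    (hg : Measurable g) : IsCoupling (μ.map f) (ν.map g) (γ.map (Prod.map f g)) := by
  constructor
  · rw [← h.1, Measure.map_map (by fun_prop) (by fun_prop),
      Measure.map_map (by fun_prop) (by fun_prop)]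
    rfl
  · rw [← h.2, Measure.map_map (by fun_prop) (by fun_prop),
      Measure.map_map (by fun_prop) (by fun_prop)]
    rfl

/-- Optimal plans are invariant under affine isometries of both spaces. -/
lemma IsGGWPlan.map_affine {μ : Measure X} {ν : Measure Y} {γ : Measure (X × Y)}
    (h : IsGGWPlan μ ν γ) (f : X ≃ᵃⁱ[ℝ] X') (g : Y ≃ᵃⁱ[ℝ] Y') :
    IsGGWPlan (μ.map f) (ν.map g) (γ.map (Prod.map f g)) := by
  have hf : Measurable f := f.continuous.measurable
  have hg : Measurable g := g.continuous.measurable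
  have hf' : Measurable f.symm := f.symm.continuous.measurable
  have hg' : Measurable g.symm := g.symm.continuous.measurable
  obtain ⟨⟨hc, hG⟩, hopt⟩ := h
  refine ⟨⟨hc.map_prodMap hf hg, isGaussian_map_affine f g γ⟩, fun γ' hc' hG' => ?_⟩
  rw [gwCost_map, ← gwCost_map f.symm g.symm γ']
  refine hopt _ ?_ (isGaussian_map_affine f.symm g.symm γ')
  have := hc'.map_prodMap hf' hg'
  rw [Measure.map_map hf' hf, Measure.map_map hg' hg] at this
  simpa [Function.comp_def] using this

end Isometries

/-! ### Disintegration of images of product measures. -/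

section Kernels

variable {A B Ω Ω' : Type*} [MeasurableSpace A] [MeasurableSpace B] [MeasurableSpace Ω]
  [MeasurableSpace Ω']

lemma map_comp_fst_prod (N' : Measure Ω') (N : Measure Ω) [IsProbabilityMeasure N]
    {f : Ω' → A} (hf : Measurable f) : (N'.prod N).map (fun w => f w.1) = N'.map f := by
  change (N'.prod N).map (f ∘ Prod.fst) = _
  rw [← Measure.map_map hf measurable_fst]
  simp

/-- The kernel `a ↦ h(a, ·)_# N`. -/
noncomputable def imageKernel (N : Measure Ω) (h : A × Ω → B) : Kernel A B :=
  (Kernel.id ×ₖ Kernel.const A N).map h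

lemma imageKernel_apply (N : Measure Ω) [IsProbabilityMeasure N] {h : A × Ω → B}
    (hh : Measurable h) (a : A) : imageKernel N h a = N.map fun ω => h (a, ω) := by
  rw [imageKernel, Kernel.map_apply _ hh, Kernel.prod_apply, Kernel.id_apply, Kernel.const_apply,
    Measure.dirac_prod, Measure.map_map hh (by fun_prop)]
  rfl

lemma isMarkovKernel_imageKernel (N : Measure Ω) [IsProbabilityMeasure N] {h : A × Ω → B}
    (hh : Measurable h) : IsMarkovKernel (imageKernel N h) :=
  Kernel.IsMarkovKernel.map _ hh

/-- The second component sees w.1 only through f w.1, and w.2 is independent of it; conditioning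
therefore amounts to freezing the first argument of h. -/
lemma isCondKernel_imageKernel (N' : Measure Ω') [IsProbabilityMeasure N'] (N : Measure Ω)
    [IsProbabilityMeasure N] {f : Ω' → A} (hf : Measurable f) {h : A × Ω → B}
    (hh : Measurable h) :
    ((N'.prod N).map fun w => (f w.1, h (f w.1, w.2))).IsCondKernel (imageKernel N h) := by
  have := isMarkovKernel_imageKernel N hh
  constructor
  have hfst : ((N'.prod N).map fun w => (f w.1, h (f w.1, w.2))).fst = N'.map f := by
    rw [Measure.fst_map_prodMk (by fun_prop), map_comp_fst_prod _ _ hf]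
  rw [hfst]
  have : IsProbabilityMeasure (N'.map f) := Measure.isProbabilityMeasure_map hf.aemeasurable
  refine Measure.ext_of_lintegral _ fun F hF => ?_
  rw [Measure.lintegral_compProd hF, lintegral_map (hF.lintegral_kernel_prod_right') hf,
    lintegral_map hF (by fun_prop), lintegral_prod _ (by fun_prop)]
  refine lintegral_congr fun z => ?_
  rw [imageKernel_apply N hh, lintegral_map (by fun_prop) (by fun_prop)]

end Kernels

/-! ### Block matrices in adapted bases and Schur complements. -/

section Blocks

variable {n k r : ℕ} (b : OrthonormalBasis (Fin k ⊕ Fin r) ℝ (EuclideanSpace ℝ (Fin n)))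

lemma dotProduct_inBasis_mulVec (S : Matrix (Fin n) (Fin n) ℝ) (x y : Fin k ⊕ Fin r → ℝ) :
    x ⬝ᵥ inBasis b S *ᵥ y = (b.repr.symm (WithLp.toLp 2 x)).ofLp ⬝ᵥ
      S *ᵥ (b.repr.symm (WithLp.toLp 2 y)).ofLp := by
  have h : ∀ v w : EuclideanSpace ℝ (Fin n), v.ofLp ⬝ᵥ S *ᵥ w.ofLp =
      inner ℝ v (S.toEuclideanLin w) := by
    intro v w
    rw [PiLp.inner_apply]
    simp [dotProduct, mul_comm]
  rw [h, ← b.sum_repr_symm, ← b.sum_repr_symm]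
  simp only [sum_inner, map_sum, inner_sum, map_smul, real_inner_smul_left, real_inner_smul_right,
    dotProduct, Matrix.mulVec, inBasis, Matrix.of_apply, Finset.mul_sum]
  rw [Finset.sum_comm]
  exact Finset.sum_congr rfl fun i _ => Finset.sum_congr rfl fun j _ => by ring

lemma isHermitian_inBasis {S : Matrix (Fin n) (Fin n) ℝ} (hS : S.PosSemidef) :
    (inBasis b S).IsHermitian := by
  have := (Matrix.isPositive_toEuclideanLin_iff.2 hS).isSymmetric
  ext i j
  simp only [Matrix.conjTranspose_apply, inBasis, Matrix.of_apply, star_trivial]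
  rw [real_inner_comm]
  exact this _ _

lemma posSemidef_inBasis {S : Matrix (Fin n) (Fin n) ℝ} (hS : S.PosSemidef) :
    (inBasis b S).PosSemidef :=
  .of_dotProduct_mulVec_nonneg (isHermitian_inBasis b hS) fun x => by
    rw [star_trivial, dotProduct_inBasis_mulVec]
    simpa using hS.dotProduct_mulVec_nonneg (b.repr.symm (WithLp.toLp 2 x)).ofLp

lemma posDef_inBasis {S : Matrix (Fin n) (Fin n) ℝ} (hS : S.PosDef) : (inBasis b S).PosDef :=
  .of_dotProduct_mulVec_pos (isHermitian_inBasis b hS.posSemidef) fun x hx => by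
    rw [star_trivial, dotProduct_inBasis_mulVec]
    have hx' : (b.repr.symm (WithLp.toLp 2 x)).ofLp ≠ 0 := by simpa using hx
    simpa using hS.dotProduct_mulVec_pos hx'

variable {M : Matrix (Fin k ⊕ Fin r) (Fin k ⊕ Fin r) ℝ}

lemma toBlocks₂₁_eq (hM : M.IsHermitian) : M.toBlocks₂₁ = M.toBlocks₁₂ᵀ := by
  ext i j
  exact (hM.apply _ _).symm

lemma fromBlocks_eq_self (hM : M.IsHermitian) :
    Matrix.fromBlocks M.toBlocks₁₁ M.toBlocks₁₂ M.toBlocks₁₂ᴴ M.toBlocks₂₂ = M := by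
  rw [Matrix.conjTranspose_eq_transpose_of_trivial, ← toBlocks₂₁_eq hM, Matrix.fromBlocks_toBlocks]

lemma posSemidef_schur (hM : M.PosSemidef) (h₁ : M.toBlocks₁₁.PosDef) : (schur M).PosSemidef := by
  have := h₁.isUnit.invertible
  have h := (Matrix.PosDef.fromBlocks₁₁ M.toBlocks₁₂ M.toBlocks₂₂ h₁).1
    (by rwa [fromBlocks_eq_self hM.1])
  rwa [Matrix.conjTranspose_eq_transpose_of_trivial] at h

/-- det M = det M₁₁ · det (M / M₁₁), so a nonzero determinant passes to the Schur complement,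
already known to be semidefinite. -/
lemma posDef_schur (hM : M.PosDef) (h₁ : M.toBlocks₁₁.PosDef) : (schur M).PosDef := by
  have := h₁.isUnit.invertible
  rw [(posSemidef_schur hM.posSemidef h₁).posDef_iff_det_ne_zero]
  have h := hM.posSemidef.posDef_iff_det_ne_zero.1 hM
  rw [← fromBlocks_eq_self hM.1, Matrix.det_fromBlocks₁₁, Matrix.invOf_eq_nonsing_inv,
    Matrix.conjTranspose_eq_transpose_of_trivial] at h
  exact right_ne_zero_of_mul h

/-- The regression matrix `M₂₁ M₁₁⁻¹`. -/
noncomputable def regression (M : Matrix (Fin k ⊕ Fin r) (Fin k ⊕ Fin r) ℝ) :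
    Matrix (Fin r) (Fin k) ℝ :=
  M.toBlocks₂₁ * M.toBlocks₁₁⁻¹

/-- Completing the square in a block quadratic form. -/
lemma dotProduct_mulVec_eq_schur (hM : M.IsHermitian) (h₁ : M.toBlocks₁₁.PosDef) (x : Fin k → ℝ)
    (y : Fin r → ℝ) :
    Sum.elim x y ⬝ᵥ M *ᵥ Sum.elim x y =
      (x + (regression M)ᵀ *ᵥ y) ⬝ᵥ M.toBlocks₁₁ *ᵥ (x + (regression M)ᵀ *ᵥ y) +
        y ⬝ᵥ schur M *ᵥ y := by
  have := h₁.isUnit.invertible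
  have h := Matrix.schur_complement_eq₁₁ M.toBlocks₁₂ M.toBlocks₂₂ x y h₁.isHermitian
  have hR : (regression M)ᵀ = M.toBlocks₁₁⁻¹ * M.toBlocks₁₂ := by
    have h2 : M.toBlocks₁₁⁻¹ᵀ = M.toBlocks₁₁⁻¹ := by
      rw [← Matrix.conjTranspose_eq_transpose_of_trivial]; exact h₁.isHermitian.inv
    rw [regression, toBlocks₂₁_eq hM, Matrix.transpose_mul, Matrix.transpose_transpose, h2]
  rw [fromBlocks_eq_self hM] at h
  simp only [star_trivial, ← Matrix.dotProduct_mulVec,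
    Matrix.conjTranspose_eq_transpose_of_trivial] at h
  rw [hR]
  exact h

end Blocks

/-! ### Gaussian vectors as base point plus regression plus independent noise. -/

section Splitting

variable {V : Type*} [NormedAddCommGroup V] [InnerProductSpace ℝ V] [FiniteDimensional ℝ V]

/-- Orthonormal bases of `E` and `Eᗮ` extracted from an adapted basis. -/
lemma IsAdapted.exists_bases {n k r : ℕ} {E : Submodule ℝ (EuclideanSpace ℝ (Fin n))}
    {b : OrthonormalBasis (Fin k ⊕ Fin r) ℝ (EuclideanSpace ℝ (Fin n))} (hb : IsAdapted E b)
    (hE : Module.finrank ℝ E = k) :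
    ∃ (u : OrthonormalBasis (Fin k) ℝ E) (v : OrthonormalBasis (Fin r) ℝ Eᗮ),
      (∀ i, (u i : EuclideanSpace ℝ (Fin n)) = b (Sum.inl i)) ∧
      ∀ j, (v j : EuclideanSpace ℝ (Fin n)) = b (Sum.inr j) := by
  have hkr : k + r = n := by
    have := Module.finrank_eq_card_basis b.toBasis
    simpa using this.symm
  have hE' : Module.finrank ℝ Eᗮ = r := by
    have := E.finrank_add_finrank_orthogonal
    simp only [hE, finrank_euclideanSpace, Fintype.card_fin] at this
    omega
  have h1 : Orthonormal ℝ fun i => (⟨b (Sum.inl i), hb.1 i⟩ : E) := by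
    rw [orthonormal_iff_ite]
    intro i j
    rw [Submodule.coe_inner, b.inner_eq_ite]
    simp
  have h2 : Orthonormal ℝ fun j => (⟨b (Sum.inr j), hb.2 j⟩ : Eᗮ) := by
    rw [orthonormal_iff_ite]
    intro i j
    rw [Submodule.coe_inner, b.inner_eq_ite]
    simp
  obtain ⟨u, hu⟩ := exists_orthonormalBasis_of_card h1 (by simp [hE])
  obtain ⟨v, hv⟩ := exists_orthonormalBasis_of_card h2 (by simp [hE'])
  exact ⟨u, v, fun i => by rw [hu], fun j => by rw [hv]⟩

variable {k r : ℕ} {E : Submodule ℝ V}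

/-- The point `m + z + (R z + ξ)`, where `z ∈ E` and `R z + ξ ∈ Eᗮ` are given by coordinates. -/
noncomputable def glue (u : OrthonormalBasis (Fin k) ℝ E) (v : OrthonormalBasis (Fin r) ℝ Eᗮ)
    (m : V) (R : Matrix (Fin r) (Fin k) ℝ)
    (w : EuclideanSpace ℝ (Fin k) × EuclideanSpace ℝ (Fin r)) : V :=
  m + ((u.repr.symm w.1 : V) + (v.repr.symm (R.toEuclideanLin w.1 + w.2) : V))

variable (u : OrthonormalBasis (Fin k) ℝ E) (v : OrthonormalBasis (Fin r) ℝ Eᗮ)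
  (m : V) (R : Matrix (Fin r) (Fin k) ℝ)
  (w : EuclideanSpace ℝ (Fin k) × EuclideanSpace ℝ (Fin r))

lemma proj_glue : proj E (glue u v m R w) = proj E m + u.repr.symm w.1 := by
  simp only [proj, glue, map_add, Submodule.orthogonalProjectionOnto_mem_subspace_eq_self,
    Submodule.orthogonalProjectionOnto_apply_of_mem_orthogonal (Submodule.coe_mem _), add_zero]

lemma proj_orthogonal_glue : proj Eᗮ (glue u v m R w) =
    proj Eᗮ m + v.repr.symm (R.toEuclideanLin w.1 + w.2) := by
  simp [proj, glue, map_add]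

lemma measurable_glue [MeasurableSpace V] [BorelSpace V] : Measurable (glue u v m R) := by
  have h1 : Measurable fun w : EuclideanSpace ℝ (Fin k) × EuclideanSpace ℝ (Fin r) =>
      (u.repr.symm w.1 : V) :=
    (continuous_subtype_val.comp (u.repr.symm.continuous.comp continuous_fst)).measurable
  have h2 : Measurable fun w : EuclideanSpace ℝ (Fin k) × EuclideanSpace ℝ (Fin r) =>
      (v.repr.symm (R.toEuclideanLin w.1 + w.2) : V) :=
    (continuous_subtype_val.comp (v.repr.symm.continuous.comp
      (((LinearMap.toContinuousLinearMap R.toEuclideanLin).continuous.comp continuous_fst).add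
        continuous_snd))).measurable
  exact (h1.add h2).const_add m

lemma repr_symm_elim {n : ℕ} {E : Submodule ℝ (EuclideanSpace ℝ (Fin n))}
    {b : OrthonormalBasis (Fin k ⊕ Fin r) ℝ (EuclideanSpace ℝ (Fin n))}
    {u : OrthonormalBasis (Fin k) ℝ E} {v : OrthonormalBasis (Fin r) ℝ Eᗮ}
    (hu : ∀ i, (u i : EuclideanSpace ℝ (Fin n)) = b (Sum.inl i))
    (hv : ∀ j, (v j : EuclideanSpace ℝ (Fin n)) = b (Sum.inr j))
    (z : EuclideanSpace ℝ (Fin k)) (y : EuclideanSpace ℝ (Fin r)) :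
    b.repr.symm (WithLp.toLp 2 (Sum.elim z.ofLp y.ofLp)) =
      (u.repr.symm z : EuclideanSpace ℝ (Fin n)) + (v.repr.symm y : EuclideanSpace ℝ (Fin n)) := by
  rw [← b.sum_repr_symm, ← u.sum_repr_symm, ← v.sum_repr_symm]
  simp [Fintype.sum_sum_type, hu, hv]

/-- A Gaussian vector, decomposed along `E ⊕ Eᗮ` into independent Gaussians. -/
lemma map_glue_prod {n : ℕ} {E : Submodule ℝ (EuclideanSpace ℝ (Fin n))}
    {b : OrthonormalBasis (Fin k ⊕ Fin r) ℝ (EuclideanSpace ℝ (Fin n))}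
    {u : OrthonormalBasis (Fin k) ℝ E} {v : OrthonormalBasis (Fin r) ℝ Eᗮ}
    (hu : ∀ i, (u i : EuclideanSpace ℝ (Fin n)) = b (Sum.inl i))
    (hv : ∀ j, (v j : EuclideanSpace ℝ (Fin n)) = b (Sum.inr j))
    (m : EuclideanSpace ℝ (Fin n)) {S : Matrix (Fin n) (Fin n) ℝ} (hS : S.PosSemidef)
    (h₁ : (inBasis b S).toBlocks₁₁.PosDef) :
    ((multivariateGaussian 0 (inBasis b S).toBlocks₁₁).prod
      (multivariateGaussian 0 (schur (inBasis b S)))).map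
        (glue u v m (regression (inBasis b S))) = multivariateGaussian m S := by
  set M := inBasis b S with hM
  have hMpsd : M.PosSemidef := posSemidef_inBasis b hS
  apply Measure.ext_of_charFun
  ext t
  let t₁ : EuclideanSpace ℝ (Fin k) := WithLp.toLp 2 fun i => b.repr t (Sum.inl i)
  let t₂ : EuclideanSpace ℝ (Fin r) := WithLp.toLp 2 fun j => b.repr t (Sum.inr j)
  have ht : WithLp.toLp 2 (Sum.elim t₁.ofLp t₂.ofLp) = b.repr t := by
    ext i
    rcases i with i | i <;> rfl
  have hin : ∀ (z : EuclideanSpace ℝ (Fin k)) (y : EuclideanSpace ℝ (Fin r)),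
      inner ℝ ((u.repr.symm z : EuclideanSpace ℝ (Fin n)) +
        (v.repr.symm y : EuclideanSpace ℝ (Fin n))) t = inner ℝ z t₁ + inner ℝ y t₂ := by
    intro z y
    rw [← repr_symm_elim hu hv, ← b.repr.inner_map_map, LinearIsometryEquiv.apply_symm_apply, ← ht]
    simp [PiLp.inner_apply, Fintype.sum_sum_type]
  have hinner : ∀ w, inner ℝ (glue u v m (regression M) w) t =
      inner ℝ m t + (inner ℝ w.1 (t₁ + (regression M)ᵀ.toEuclideanLin t₂) + inner ℝ w.2 t₂) := by
    intro w
    rw [glue, inner_add_left, hin, inner_add_left, inner_add_right,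
      real_inner_comm t₂, inner_toEuclideanLin_right, real_inner_comm w.1]
    ring
  rw [charFun_apply, integral_map (measurable_glue u v m _).aemeasurable (by fun_prop)]
  simp only [hinner, Complex.ofReal_add, add_mul, Complex.exp_add]
  rw [integral_const_mul, integral_prod_mul
    (f := fun z => Complex.exp
      (((inner ℝ z (t₁ + (regression M)ᵀ.toEuclideanLin t₂) : ℝ) : ℂ) * Complex.I))
    (g := fun y => Complex.exp (((inner ℝ y t₂ : ℝ) : ℂ) * Complex.I)),
    ← charFun_apply, ← charFun_apply, charFun_multivariateGaussian h₁.posSemidef,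
    charFun_multivariateGaussian (posSemidef_schur hMpsd h₁), charFun_multivariateGaussian hS,
    ← Complex.exp_add, ← Complex.exp_add]
  -- Independence has split the characteristic function into two Gaussian factors; completing the
  -- square shows that their exponents add up to the quadratic form of S.
  have hq := dotProduct_mulVec_eq_schur hMpsd.1 h₁ t₁.ofLp t₂.ofLp
  rw [hM, dotProduct_inBasis_mulVec, ht, LinearIsometryEquiv.symm_apply_apply, ← hM] at hq
  rw [hq, real_inner_comm]
  congr 1
  simp
  ring

end Splitting

/-! ### Gluing optimal maps into a Monge-Knothe map. -/

section MongeKnotheMap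

lemma measurable_proj {V : Type*} [NormedAddCommGroup V] [InnerProductSpace ℝ V]
    [FiniteDimensional ℝ V] [MeasurableSpace V] [BorelSpace V] (E : Submodule ℝ V) :
    Measurable (proj E) :=
  E.orthogonalProjectionOnto.continuous.measurable

variable {p q k r s : ℕ}

/-- The lower row of the block matrix, in terms of the regression matrices. -/
lemma lowerBlock_add_mul_regression {M : Matrix (Fin k ⊕ Fin r) (Fin k ⊕ Fin r) ℝ}
    {N : Matrix (Fin k ⊕ Fin s) (Fin k ⊕ Fin s) ℝ} {T₁ : Matrix (Fin k) (Fin k) ℝ}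
    (T₂ : Matrix (Fin s) (Fin r) ℝ) (hM : IsUnit M.toBlocks₁₁) (hT₁ : IsUnit T₁)
    (h : T₁ * M.toBlocks₁₁ * T₁ᵀ = N.toBlocks₁₁) :
    lowerBlock M N T₁ T₂ + T₂ * regression M = regression N * T₁ := by
  have hdM := (Matrix.isUnit_iff_isUnit_det _).1 hM
  have hdT := (Matrix.isUnit_iff_isUnit_det _).1 hT₁
  -- Inverting Λ_F = T₁ Σ_E T₁ᵀ trades Λ_F⁻¹ T₁ for (T₁ᵀ)⁻¹ Σ_E⁻¹, the factor appearing in C.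
  have h1 : N.toBlocks₁₁⁻¹ * T₁ = (T₁ᵀ)⁻¹ * M.toBlocks₁₁⁻¹ := by
    rw [← h, Matrix.mul_inv_rev, Matrix.mul_inv_rev, Matrix.mul_assoc, Matrix.mul_assoc,
      Matrix.nonsing_inv_mul _ hdT, Matrix.mul_one]
  rw [regression, regression, lowerBlock, Matrix.mul_assoc N.toBlocks₂₁, h1, Matrix.sub_mul,
    Matrix.mul_assoc T₂, Matrix.mul_assoc N.toBlocks₂₁, sub_add_cancel]

/-- The lower row sends (z, R z + ξ) to (C + T₂ R) z + T₂ ξ = R' T₁ z + T₂ ξ, so the map becomes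
block diagonal in the independent coordinates (z, ξ). -/
lemma affineInBases_glue {E : Submodule ℝ (EuclideanSpace ℝ (Fin p))}
    {F : Submodule ℝ (EuclideanSpace ℝ (Fin q))}
    {b : OrthonormalBasis (Fin k ⊕ Fin r) ℝ (EuclideanSpace ℝ (Fin p))}
    {c : OrthonormalBasis (Fin k ⊕ Fin s) ℝ (EuclideanSpace ℝ (Fin q))}
    {u : OrthonormalBasis (Fin k) ℝ E} {v : OrthonormalBasis (Fin r) ℝ Eᗮ}
    {u' : OrthonormalBasis (Fin k) ℝ F} {v' : OrthonormalBasis (Fin s) ℝ Fᗮ}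
    (hu : ∀ i, (u i : EuclideanSpace ℝ (Fin p)) = b (Sum.inl i))
    (hv : ∀ j, (v j : EuclideanSpace ℝ (Fin p)) = b (Sum.inr j))
    (hu' : ∀ i, (u' i : EuclideanSpace ℝ (Fin q)) = c (Sum.inl i))
    (hv' : ∀ j, (v' j : EuclideanSpace ℝ (Fin q)) = c (Sum.inr j))
    (m : EuclideanSpace ℝ (Fin p)) (m' : EuclideanSpace ℝ (Fin q))
    {T₁ : Matrix (Fin k) (Fin k) ℝ} {T₂ : Matrix (Fin s) (Fin r) ℝ}
    {C R' : Matrix (Fin s) (Fin k) ℝ} {R : Matrix (Fin r) (Fin k) ℝ}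
    (h : C + T₂ * R = R' * T₁) (w : EuclideanSpace ℝ (Fin k) × EuclideanSpace ℝ (Fin r)) :
    affineInBases b c m m' (Matrix.fromBlocks T₁ 0 C T₂) (glue u v m R w) =
      glue u' v' m' R' (T₁.toEuclideanLin w.1, T₂.toEuclideanLin w.2) := by
  rw [affineInBases, glue, add_sub_cancel_left, ← repr_symm_elim hu hv,
    LinearIsometryEquiv.apply_symm_apply, glue, ← repr_symm_elim hu' hv']
  congr 2
  rw [Matrix.toLpLin_toLp, Matrix.toLin'_apply, Matrix.fromBlocks_mulVec]
  congr 1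
  congr 1
  · simp
  · simp [Matrix.mulVec_add, ← add_assoc, ← h, Matrix.add_mulVec]

/-- Optimal linear maps on `E` and on the conditional distributions glue to a Monge-Knothe map. -/
theorem isMongeKnotheMap_affineInBases {E : Submodule ℝ (EuclideanSpace ℝ (Fin p))}
    {F : Submodule ℝ (EuclideanSpace ℝ (Fin q))}
    {b : OrthonormalBasis (Fin k ⊕ Fin r) ℝ (EuclideanSpace ℝ (Fin p))}
    {c : OrthonormalBasis (Fin k ⊕ Fin s) ℝ (EuclideanSpace ℝ (Fin q))}
    (hE : Module.finrank ℝ E = k) (hF : Module.finrank ℝ F = k)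
    (hb : IsAdapted E b) (hc : IsAdapted F c)
    (m : EuclideanSpace ℝ (Fin p)) (m' : EuclideanSpace ℝ (Fin q))
    {S : Matrix (Fin p) (Fin p) ℝ} {L : Matrix (Fin q) (Fin q) ℝ}
    (hS : S.PosSemidef) (hL : L.PosSemidef)
    (hSE : (inBasis b S).toBlocks₁₁.PosDef) (hLF : (inBasis c L).toBlocks₁₁.PosDef)
    {T₁ : Matrix (Fin k) (Fin k) ℝ} {T₂ : Matrix (Fin s) (Fin r) ℝ}
    (hT₁ : IsGGWMatrix (inBasis b S).toBlocks₁₁ (inBasis c L).toBlocks₁₁ T₁)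
    (hT₂ : IsGGWMatrix (schur (inBasis b S)) (schur (inBasis c L)) T₂) (hunit : IsUnit T₁) :
    IsMongeKnotheMap E F (multivariateGaussian m S) (multivariateGaussian m' L)
      (affineInBases b c m m'
        (Matrix.fromBlocks T₁ 0 (lowerBlock (inBasis b S) (inBasis c L) T₁ T₂) T₂)) := by
  obtain ⟨u, v, hu, hv⟩ := hb.exists_bases hE
  obtain ⟨u', v', hu', hv'⟩ := hc.exists_bases hF
  have hμ := map_glue_prod hu hv m hS hSE
  have hν := map_glue_prod hu' hv' m' hL hLF
  have hT₁m := measurable_toEuclideanLin T₁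
  have hT₂m := measurable_toEuclideanLin T₂
  have hT₁L := (isCoupling_graph_iff hT₁m).1 hT₁.2.1.1
  have hT₂L := (isCoupling_graph_iff hT₂m).1 hT₂.2.1.1
  have hblock := lowerBlock_add_mul_regression T₂ hSE.isUnit hunit
    (hT₁.mul_mul_transpose hSE.posSemidef hLF.posSemidef)
  set T := affineInBases b c m m'
    (Matrix.fromBlocks T₁ 0 (lowerBlock (inBasis b S) (inBasis c L) T₁ T₂) T₂)
  set R := regression (inBasis b S)
  set R' := regression (inBasis c L)
  have hTglue : ∀ w, T (glue u v m R w) =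
      glue u' v' m' R' (T₁.toEuclideanLin w.1, T₂.toEuclideanLin w.2) :=
    affineInBases_glue hu hv hu' hv' m m' hblock
  have hTm : Measurable T := by
    have h1 : Measurable (Matrix.fromBlocks T₁ 0
        (lowerBlock (inBasis b S) (inBasis c L) T₁ T₂) T₂).toEuclideanLin :=
      (LinearMap.toContinuousLinearMap _).continuous.measurable
    exact (c.repr.symm.continuous.measurable.comp (h1.comp
      (b.repr.continuous.measurable.comp (measurable_id.sub_const m)))).const_add m'
  have hg := measurable_glue u v m R
  have hg' := measurable_glue u' v' m' R'
  have hRm := measurable_toEuclideanLin R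
  have hRm' := measurable_toEuclideanLin R'
  have hum := u.repr.symm.continuous.measurable
  have hvm := v.repr.symm.continuous.measurable
  have hum' := u'.repr.symm.continuous.measurable
  have hvm' := v'.repr.symm.continuous.measurable
  have hui := u.repr.continuous.measurable
  have hui' := u'.repr.continuous.measurable
  have pE := measurable_proj E
  have pE' := measurable_proj Eᗮ
  have pF := measurable_proj F
  have pF' := measurable_proj Fᗮ
  set N₁ := multivariateGaussian 0 (inBasis b S).toBlocks₁₁
  set N₂ := multivariateGaussian 0 (schur (inBasis b S))
  set N₁' := multivariateGaussian 0 (inBasis c L).toBlocks₁₁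
  set N₂' := multivariateGaussian 0 (schur (inBasis c L))
  -- affine isometries between coordinates and the fibers
  let fE : EuclideanSpace ℝ (Fin k) ≃ᵃⁱ[ℝ] E :=
    u.repr.symm.toAffineIsometryEquiv.trans (AffineIsometryEquiv.constVAdd ℝ E (proj E m))
  let fF : EuclideanSpace ℝ (Fin k) ≃ᵃⁱ[ℝ] F :=
    u'.repr.symm.toAffineIsometryEquiv.trans (AffineIsometryEquiv.constVAdd ℝ F (proj F m'))
  have hfE : ∀ z, fE z = proj E m + u.repr.symm z := fun z => rfl
  have hfF : ∀ z, fF z = proj F m' + u'.repr.symm z := fun z => rfl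
  -- The regression term of the conditional mean, as a function of the point of E instead of its
  -- centred coordinates z.
  let shiftE : E → EuclideanSpace ℝ (Fin r) := fun x => R.toEuclideanLin (u.repr (x - proj E m))
  let shiftF : F → EuclideanSpace ℝ (Fin s) := fun y => R'.toEuclideanLin (u'.repr (y - proj F m'))
  have hshiftE : ∀ z, shiftE (fE z) = R.toEuclideanLin z := fun z => by simp [shiftE, hfE]
  have hshiftF : ∀ z, shiftF (fF z) = R'.toEuclideanLin z := fun z => by simp [shiftF, hfF]
  have hshiftEm : Measurable shiftE := hRm.comp (hui.comp (measurable_id.sub_const _))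
  have hshiftFm : Measurable shiftF := hRm'.comp (hui'.comp (measurable_id.sub_const _))
  let hμ' : E × EuclideanSpace ℝ (Fin r) → Eᗮ := fun a =>
    proj Eᗮ m + v.repr.symm (shiftE a.1 + a.2)
  let hν' : F × EuclideanSpace ℝ (Fin s) → Fᗮ := fun a =>
    proj Fᗮ m' + v'.repr.symm (shiftF a.1 + a.2)
  -- One noise variable drives both fibers: ξ on the source side, T₂ ξ on the target side.
  let hπ' : (E × F) × EuclideanSpace ℝ (Fin r) → Eᗮ × Fᗮ := fun a =>
    (hμ' (a.1.1, a.2), hν' (a.1.2, T₂.toEuclideanLin a.2))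
  have hμm : Measurable hμ' := by fun_prop
  have hνm : Measurable hν' := by fun_prop
  have hπm : Measurable hπ' := by fun_prop
  -- For a frozen base point, the fiber map `hμ'` is an affine isometry in the noise; this is what
  -- transports optimality to the fibers.
  let aE : E → EuclideanSpace ℝ (Fin r) ≃ᵃⁱ[ℝ] Eᗮ := fun x =>
    ((AffineIsometryEquiv.constVAdd ℝ _ (shiftE x)).trans
      v.repr.symm.toAffineIsometryEquiv).trans (AffineIsometryEquiv.constVAdd ℝ _ (proj Eᗮ m))
  let aF : F → EuclideanSpace ℝ (Fin s) ≃ᵃⁱ[ℝ] Fᗮ := fun y =>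
    ((AffineIsometryEquiv.constVAdd ℝ _ (shiftF y)).trans
      v'.repr.symm.toAffineIsometryEquiv).trans (AffineIsometryEquiv.constVAdd ℝ _ (proj Fᗮ m'))
  have hfEm : Measurable fE := fE.continuous.measurable
  have hfFm : Measurable fF := fF.continuous.measurable
  have hcpl : IsCoupling (multivariateGaussian m S) (multivariateGaussian m' L)
      ((multivariateGaussian m S).map fun x => (x, T x)) := by
    rw [isCoupling_graph_iff hTm, ← hμ, ← hν, ← hT₁L, ← hT₂L,
      Measure.map_prod_map _ _ hT₁m hT₂m, Measure.map_map hTm hg,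
      Measure.map_map hg' (by fun_prop)]
    congr 1
    funext w
    exact hTglue w
  have hμE : (multivariateGaussian m S).map (proj E) = N₁.map fE := by
    rw [← hμ, ← map_comp_fst_prod N₁ N₂ hfEm, Measure.map_map pE hg]
    congr 1
    funext w
    exact proj_glue u v m R w
  have hνF : (multivariateGaussian m' L).map (proj F) = N₁'.map fF := by
    rw [← hν, ← map_comp_fst_prod N₁' N₂' hfFm, Measure.map_map pF hg']
    congr 1
    funext w
    exact proj_glue u' v' m' R' w
  have hπEF : ((multivariateGaussian m S).map fun x => (x, T x)).map
      (fun z => (proj E z.1, proj F z.2)) =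
      (N₁.map fun z => (z, T₁.toEuclideanLin z)).map (Prod.map fE fF) := by
    rw [Measure.map_map (by fun_prop) (by fun_prop), Measure.map_map (by fun_prop) (by fun_prop),
      ← map_comp_fst_prod N₁ N₂ (by fun_prop), ← hμ, Measure.map_map (by fun_prop) hg]
    congr 1
    funext w
    simp only [Function.comp_apply, hTglue, proj_glue, Prod.map_apply, hfE, hfF]
  refine ⟨hTm, hcpl, ?_, imageKernel N₂ hμ', imageKernel N₂' hν', imageKernel N₂ hπ',
    isMarkovKernel_imageKernel _ hμm, isMarkovKernel_imageKernel _ hνm,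
    isMarkovKernel_imageKernel _ hπm, ?_, ?_, ?_, .of_forall fun z => ?_⟩
  · rw [hμE, hνF, hπEF]
    exact hT₁.2.map_affine fE fF
  · have : splitMeasure E (multivariateGaussian m S) =
        (N₁.prod N₂).map fun w => (fE w.1, hμ' (fE w.1, w.2)) := by
      rw [splitMeasure, ← hμ, Measure.map_map (by fun_prop) hg]
      congr 1
      funext w
      simp only [Function.comp_apply, proj_glue, proj_orthogonal_glue, hμ', ← hfE, hshiftE]
    rw [this]
    exact isCondKernel_imageKernel N₁ N₂ hfEm hμm
  · have : splitMeasure F (multivariateGaussian m' L) =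
        (N₁'.prod N₂').map fun w => (fF w.1, hν' (fF w.1, w.2)) := by
      rw [splitMeasure, ← hν, Measure.map_map (by fun_prop) hg']
      congr 1
      funext w
      simp only [Function.comp_apply, proj_glue, proj_orthogonal_glue, hν', ← hfF, hshiftF]
    rw [this]
    exact isCondKernel_imageKernel N₁' N₂' hfFm hνm
  · have : splitPlan E F ((multivariateGaussian m S).map fun x => (x, T x)) =
        (N₁.prod N₂).map fun w => ((fE w.1, fF (T₁.toEuclideanLin w.1)),
          hπ' ((fE w.1, fF (T₁.toEuclideanLin w.1)), w.2)) := by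
      rw [splitPlan, ← hμ, Measure.map_map (by fun_prop) hg,
        Measure.map_map (by fun_prop) (by fun_prop)]
      congr 1
      funext w
      simp only [Function.comp_apply, hTglue, proj_glue, proj_orthogonal_glue, hπ', hμ', hν',
        ← hfE, ← hfF, hshiftE, hshiftF]
    rw [this]
    exact isCondKernel_imageKernel N₁ N₂ (f := fun z => (fE z, fF (T₁.toEuclideanLin z)))
      (by fun_prop) hπm
  · rw [imageKernel_apply _ hμm, imageKernel_apply _ hνm, imageKernel_apply _ hπm]
    -- The fiber plan over z is the graph plan of T₂ moved by two affine isometries; optimality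
    -- holds at every z, not just almost every one.
    have := hT₂.2.map_affine (aE z.1) (aF z.2)
    rw [Measure.map_map ((aE z.1).continuous.measurable.prodMap (aF z.2).continuous.measurable)
      (by fun_prop)] at this
    exact this

end MongeKnotheMap

end GaussianDetour

/-! ### Assembly of the proposition. -/

theorem mainTheorem5 {p q k r s : ℕ} (hpq : q ≤ p)
    (E : Submodule ℝ (EuclideanSpace ℝ (Fin p))) (F : Submodule ℝ (EuclideanSpace ℝ (Fin q)))
    (hE : Module.finrank ℝ E = k) (hF : Module.finrank ℝ F = k)
    (b : OrthonormalBasis (Fin k ⊕ Fin r) ℝ (EuclideanSpace ℝ (Fin p)))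
    (c : OrthonormalBasis (Fin k ⊕ Fin s) ℝ (EuclideanSpace ℝ (Fin q)))
    (hb : GaussianDetour.IsAdapted E b) (hc : GaussianDetour.IsAdapted F c)
    (mμ : EuclideanSpace ℝ (Fin p)) (mν : EuclideanSpace ℝ (Fin q))
    (S : Matrix (Fin p) (Fin p) ℝ) (L : Matrix (Fin q) (Fin q) ℝ)
    (hS : S.PosSemidef) (hL : L.PosSemidef)
    (hSE : (GaussianDetour.inBasis b S).toBlocks₁₁.PosDef)
    (hLF : (GaussianDetour.inBasis c L).toBlocks₁₁.PosDef) :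
    -- the maps of spectral form exist
    (∃ T₁, GaussianDetour.IsSpectralMap
      (GaussianDetour.inBasis b S).toBlocks₁₁ (GaussianDetour.inBasis c L).toBlocks₁₁ T₁) ∧
    (S.PosDef → ∃ T₂, GaussianDetour.IsSpectralMap
      (GaussianDetour.schur (GaussianDetour.inBasis b S))
      (GaussianDetour.schur (GaussianDetour.inBasis c L)) T₂) ∧
    -- and they are optimal transport maps
    (∀ T₁, GaussianDetour.IsSpectralMap
        (GaussianDetour.inBasis b S).toBlocks₁₁ (GaussianDetour.inBasis c L).toBlocks₁₁ T₁ →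
      GaussianDetour.IsGGWMatrix
        (GaussianDetour.inBasis b S).toBlocks₁₁ (GaussianDetour.inBasis c L).toBlocks₁₁ T₁) ∧
    (∀ T₂, GaussianDetour.IsSpectralMap
        (GaussianDetour.schur (GaussianDetour.inBasis b S))
        (GaussianDetour.schur (GaussianDetour.inBasis c L)) T₂ →
      GaussianDetour.IsGGWMatrix
        (GaussianDetour.schur (GaussianDetour.inBasis b S))
        (GaussianDetour.schur (GaussianDetour.inBasis c L)) T₂) ∧
    -- any two linear optimal transport maps yield a Monge-Knothe map
    ∀ T₁ T₂,
      GaussianDetour.IsGGWMatrix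
        (GaussianDetour.inBasis b S).toBlocks₁₁ (GaussianDetour.inBasis c L).toBlocks₁₁ T₁ →
      GaussianDetour.IsGGWMatrix
        (GaussianDetour.schur (GaussianDetour.inBasis b S))
        (GaussianDetour.schur (GaussianDetour.inBasis c L)) T₂ →
      IsUnit T₁ ∧
      GaussianDetour.IsMongeKnotheMap E F (multivariateGaussian mμ S) (multivariateGaussian mν L)
        (GaussianDetour.affineInBases b c mμ mν
          (Matrix.fromBlocks T₁ 0
            (GaussianDetour.lowerBlock (GaussianDetour.inBasis b S) (GaussianDetour.inBasis c L)
              T₁ T₂)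
            T₂)) := by
  have hpk : k + r = p := by simpa using (Module.finrank_eq_card_basis b.toBasis).symm
  have hqk : k + s = q := by simpa using (Module.finrank_eq_card_basis c.toBasis).symm
  -- Removing the common dimension k from q ≤ p gives the dimension inequality needed for optimality
  -- of spectral maps on the complements.
  have hsr : s ≤ r := by omega
  have hSs := GaussianDetour.posSemidef_schur (GaussianDetour.posSemidef_inBasis b hS) hSE
  have hLs := GaussianDetour.posSemidef_schur (GaussianDetour.posSemidef_inBasis c hL) hLF
  refine ⟨GaussianDetour.exists_isSpectralMap hSE hLF.posSemidef,
    fun h => GaussianDetour.exists_isSpectralMap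
      (GaussianDetour.posDef_schur (GaussianDetour.posDef_inBasis b h) hSE) hLs,
    fun T₁ h => h.isGGWMatrix le_rfl hSE.posSemidef hLF.posSemidef,
    fun T₂ h => h.isGGWMatrix hsr hSs hLs, fun T₁ T₂ h₁ h₂ => ?_⟩
  -- Since T₁ transports one Gaussian to the other, T₁ Σ_E T₁ᵀ = Λ_F is invertible; hence det T₁ is
  -- a unit.
  have hunit : IsUnit T₁ := by
    have h := hLF.isUnit
    rw [← h₁.mul_mul_transpose hSE.posSemidef hLF.posSemidef, Matrix.mul_assoc,
      Matrix.isUnit_iff_isUnit_det, Matrix.det_mul] at h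
    exact (Matrix.isUnit_iff_isUnit_det _).2 (isUnit_of_mul_isUnit_left h)
  exact ⟨hunit, GaussianDetour.isMongeKnotheMap_affineInBases hE hF hb hc mμ mν hS hL hSE hLF h₁ h₂
    hunit⟩
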